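/- Let $k$ be a field. A \emph{finite tensor category} over $k$ is a rigid monoidal category whose underlying category is a $k$-linear abelian category, $k$-linearly equivalent to the category of finitely generated modules over some finite-dimensional $k$-algebra, and whose tensor product is $k$-linear in each variable (the unit object $\mathbf 1$ need not be simple). The left dual of $X$ is denoted by $X^*$, with evaluation $X^*\otimes X\to\mathbf 1$. For a finite tensor category $\mathcal C$ let $\mathrm{Rex}(\mathcal C)$ be the category of $k$-linear right exact endofunctors of $\mathcal C$ and natural transformations. For a finite-dimensional vector space $V$ and $M\in\mathcal C$, let $V\bullet M\in\mathcal C$ be the object with $\mathrm{Hom}_{\mathcal C}(V\bullet M,N)\cong\mathrm{Hom}_k(V,\mathrm{Hom}_{\mathcal C}(M,N))$ naturally in $N$. The Cayley functor $\Upsilon_{\mathcal C}:\mathcal C\to\mathrm{Rex}(\mathcal C)$, $X\mapsto(-)\otimes X$, has a left adjoint $\Upsilon_{\mathcal C}^*$, and the \emph{modular object} of $\mathcal C$ is $$\alpha_{\mathcal C}=\Upsilon_{\mathcal C}^*\bigl[\mathrm{Hom}_{\mathcal C}(-,\mathbf 1)^*\bullet\mathbf 1\bigr].$$ Let $F:\mathcal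 C\to\mathcal D$ be an exact tensor functor (that is, an exact $k$-linear strong monoidal functor) between finite tensor categories over $k$, and let $L\dashv F\dashv R$. Suppose that one of the following (equivalent) conditions holds: (1) $L$ has a left adjoint; (2) $R$ has a right adjoint; (3) there is an object $\chi\in\mathcal D$ with $R\cong L(-\otimes\chi)$; (4) $L$ is exact; (5) $R$ is exact; (6) $F(P)$ is projective for every projective object $P\in\mathcal C$; (7) $F(P)$ is projective for some projective generator $P\in\mathcal C$. Then there exists a \emph{relative modular object} of $F$, i.e. an object $\chi_F\in\mathcal D$ with $R\cong L(-\otimes\chi_F)$, and every such $\chi_F$ satisfies $$\chi_F\otimes\alpha_{\mathcal D}\;\cong\;F(\alpha_{\mathcal C})\;\cong\;\alpha_{\mathcal D}\otimes\chi_F .$$ If, moreover, $F(\alpha_{\mathcal C})$ or $\alpha_{\mathcal D}$ is an invertible object, then $$\alpha_{\mathcal D}^*\otimes F(\alpha_{\mathcal C})\;\cong\;\chi_F\;\cong\;F(\alpha_{\mathcal C})\otimes\alpha_{\mathcal D}^* .$$ -/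

import Mathlib

open CategoryTheory CategoryTheory.Limits MonoidalCategory

universe w v u v₁ u₁ v₂ u₂

noncomputable section

namespace FinTensor

attribute [local instance] Abelian.hasFiniteBiproducts

/-- A `k`-linear abelian category is finite if it is `k`-linearly equivalent to the category of
finitely generated modules over a finite-dimensional `k`-algebra. (Right modules over an algebra
are left modules over its opposite algebra, so the side does not matter.) -/
class IsFiniteAbelian (k : Type w) [Field k] (C : Type u) [Category.{v} C] [Abelian C]
    [Linear k C] : Prop where
  exists_equivalence : ∃ (A : Type w) (_ : Ring A) (_ : Algebra k A) (_ : Module.Finite k A)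
    (e : C ≌ FGModuleCat.{w} A), e.functor.Additive ∧ e.functor.Linear k

section Finite

variable (k : Type w) [Field k] {C : Type u} [Category.{v} C] [Abelian C] [Linear k C]

open scoped ModuleCat in
theorem fgModuleCat_finite_hom {A : Type w} [Ring A] [Algebra k A] [Module.Finite k A]
    (M N : FGModuleCat.{w} A) : Module.Finite k (M ⟶ N) := by
  have : Module.Finite k M.obj := Module.Finite.trans A M.obj
  have : Module.Finite k N.obj := Module.Finite.trans A N.obj
  let f : (M ⟶ N) →ₗ[k] (M.obj →ₗ[k] N.obj) :=
    { toFun := fun g => g.hom.hom.restrictScalars k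
      map_add' := fun _ _ => rfl
      map_smul' := fun _ _ => rfl }
  refine Module.Finite.of_injective f fun g h hgh => ?_
  ext x
  exact LinearMap.congr_fun hgh x

theorem fgModuleCat_surjective {A : Type w} [Ring A] {M N : FGModuleCat.{w} A} (f : M ⟶ N)
    [Epi f] : Function.Surjective f.hom.hom := by
  rw [← LinearMap.range_eq_top, ← Submodule.ker_mkQ (LinearMap.range f.hom.hom),
    LinearMap.ker_eq_top]
  let q : N ⟶ FGModuleCat.of A (N ⧸ LinearMap.range f.hom.hom) :=
    FGModuleCat.ofHom (LinearMap.range f.hom.hom).mkQ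
  have h : f ≫ q = f ≫ FGModuleCat.ofHom 0 := by
    ext x
    change (LinearMap.range f.hom.hom).mkQ (f.hom.hom x) = 0
    simp
  have h' := (cancel_epi f).1 h
  exact congrArg (fun t => t.hom.hom) h'

variable [IsFiniteAbelian k C]

instance finite_hom (X Y : C) : Module.Finite k (X ⟶ Y) := by
  obtain ⟨A, _, _, _, e, _, _⟩ := IsFiniteAbelian.exists_equivalence (k := k) (C := C)
  have := fgModuleCat_finite_hom k (e.functor.obj X) (e.functor.obj Y)
  exact Module.Finite.of_injective (e.functor.mapLinearMap k (X := X) (Y := Y))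
    e.functor.map_injective

end Finite

theorem exists_projective_separator (k : Type w) [Field k] (C : Type u) [Category.{v} C]
    [Abelian C] [Linear k C] [IsFiniteAbelian k C] : ∃ P : C, Projective P ∧ IsSeparator P := by
  obtain ⟨A, _, _, _, e, _, _⟩ := IsFiniteAbelian.exists_equivalence (k := k) (C := C)
  have hs : IsSeparator (FGModuleCat.of A A) := by
    rw [isSeparator_def]
    intro M N f g h
    ext x
    have := h (FGModuleCat.ofHom (LinearMap.toSpanSingleton A M x))
    have := congrArg (fun q => q.hom.hom (1 : A)) this
    change f.hom.hom ((1 : A) • x) = g.hom.hom ((1 : A) • x) at this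
    simpa using this
  have hp : Projective (FGModuleCat.of A A) := by
    refine ⟨fun {M N} f q _ => ?_⟩
    obtain ⟨y, hy⟩ := fgModuleCat_surjective q (f.hom.hom (1 : A))
    refine ⟨FGModuleCat.ofHom (LinearMap.toSpanSingleton A M y), ?_⟩
    ext
    change q.hom.hom ((1 : A) • y) = f.hom.hom (1 : A)
    rw [one_smul, hy]
  refine ⟨e.inverse.obj (FGModuleCat.of A A), ?_, hs.of_equivalence e.symm⟩
  exact (e.symm.map_projective_iff _).2 hp

section Dual

variable {C : Type u} [Category.{v} C] [MonoidalCategory C]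

theorem evalLeft_bijective (P X Y : C) [ExactPairing Y P] :
    Function.Bijective (fun f : X ⟶ Y => P ◁ f ≫ ε_ Y P) := by
  let _ : HasLeftDual P := ⟨Y⟩
  rw [← (tensorLeftHomEquiv X Y P (𝟙_ C)).comp_bijective]
  have : (tensorLeftHomEquiv X Y P (𝟙_ C)) ∘ (fun f : X ⟶ Y => P ◁ f ≫ ε_ Y P) =
      (ρ_ Y).symm.homToEquiv := by
    ext f
    exact tensorLeftHomEquiv_whiskerLeft_comp_evaluation (Z := P) f
  rw [this]
  exact Equiv.bijective _

variable [RigidCategory C]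

theorem mate_epi {S X : C} (i : S ⟶ X) [Mono i] : Epi (iᘁ) := by
  refine ⟨fun {V} a b h => ?_⟩
  have := (tensorRightAdjunction (ᘁV) V).isRightAdjoint
  have hm : Mono (i ▷ V) := inferInstanceAs (Mono ((tensorRight V).map i))
  have key : ∀ c : Sᘁ ⟶ V, (η_ X (Xᘁ)) ≫ X ◁ (iᘁ ≫ c) = ((η_ S (Sᘁ)) ≫ S ◁ c) ≫ i ▷ V := by
    intro c
    rw [MonoidalCategory.whiskerLeft_comp, ← Category.assoc, coevaluation_comp_rightAdjointMate,
      Category.assoc, Category.assoc, whisker_exchange]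
  have h1 : (η_ S (Sᘁ)) ≫ S ◁ a = (η_ S (Sᘁ)) ≫ S ◁ b := by
    rw [← cancel_mono (i ▷ V), ← key, ← key, h]
  have h2 := congrArg (tensorLeftHomEquiv (𝟙_ C) S (Sᘁ) V).symm h1
  simpa [tensorLeftHomEquiv_symm_coevaluation_comp_whiskerLeft] using h2

/-- The bijection `Hom(P, X*) ≃ Hom(P ⊗ X, 1)`. -/
theorem evalRight_bijective (P X : C) :
    Function.Bijective (fun f : P ⟶ Xᘁ => f ▷ X ≫ ε_ X (Xᘁ)) := by
  rw [← (tensorRightHomEquiv P X (Xᘁ) (𝟙_ C)).comp_bijective]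
  have : (tensorRightHomEquiv P X (Xᘁ) (𝟙_ C)) ∘ (fun f : P ⟶ Xᘁ => f ▷ X ≫ ε_ X (Xᘁ)) =
      (λ_ (Xᘁ)).symm.homToEquiv := by
    ext f
    simp
  rw [this]
  exact Equiv.bijective _

theorem injective_leftDual (P : C) [Projective P] : Injective (ᘁP) := by
  refine ⟨fun {S X} g i _ => ?_⟩
  have := mate_epi i
  obtain ⟨f, hf⟩ := (evalRight_bijective P S).2 (P ◁ g ≫ ε_ (ᘁP) P)
  obtain ⟨h, hh⟩ := (evalLeft_bijective P X (ᘁP)).2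
    (Projective.factorThru f (iᘁ) ▷ X ≫ ε_ X (Xᘁ))
  refine ⟨h, (evalLeft_bijective P S (ᘁP)).1 ?_⟩
  dsimp only at hf hh ⊢
  rw [MonoidalCategory.whiskerLeft_comp, Category.assoc, hh, ← hf, whisker_exchange_assoc,
    ← rightAdjointMate_comp_evaluation, ← comp_whiskerRight_assoc, Projective.factorThru_comp]

theorem isCoseparator_leftDual (P : C) (hP : IsSeparator P) : IsCoseparator (ᘁP) := by
  rw [isCoseparator_def]
  intro X Y f g h
  have hd : fᘁ = gᘁ := by
    refine (isSeparator_def P).1 hP _ _ fun q => (evalRight_bijective P X).1 ?_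
    obtain ⟨t, ht⟩ := (evalLeft_bijective P Y (ᘁP)).2 (q ▷ Y ≫ ε_ Y (Yᘁ))
    dsimp only at ht ⊢
    rw [comp_whiskerRight_assoc, comp_whiskerRight_assoc, rightAdjointMate_comp_evaluation,
      rightAdjointMate_comp_evaluation, ← whisker_exchange_assoc, ← whisker_exchange_assoc,
      ← ht, ← MonoidalCategory.whiskerLeft_comp_assoc, ← MonoidalCategory.whiskerLeft_comp_assoc,
      h t]
  refine (evalLeft_bijective (Yᘁ) X Y).1 ?_
  dsimp only
  rw [← rightAdjointMate_comp_evaluation, ← rightAdjointMate_comp_evaluation, hd]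

end Dual

section AdjointFunctor

variable (k : Type w) [Field k] {C : Type u₁} [Category.{v₁} C] [Abelian C] [Linear k C]
  {E : Type u₂} [Category.{v₂} E]

/-- `x : T ⟶ G X` is minimal if it does not factor through `G S` for a proper subobject `S`. -/
def IsMinimalArrow (G : C ⥤ E) {T : E} {X : C} (x : T ⟶ G.obj X) : Prop :=
  ∀ ⦃S : C⦄ (i : S ⟶ X) (_ : Mono i) (s : T ⟶ G.obj S), s ≫ G.map i = x → IsIso i

theorem IsMinimalArrow.eq_of_comp_eq {G : C ⥤ E} [PreservesFiniteLimits G] {T : E} {X : C}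
    {x : T ⟶ G.obj X} (hx : IsMinimalArrow G x) {Y : C} (f g : X ⟶ Y)
    (h : x ≫ G.map f = x ≫ G.map g) : f = g := by
  have hl := isLimitForkMapOfIsLimit G (equalizer.condition f g) (equalizerIsEqualizer f g)
  obtain ⟨s, hs⟩ := Fork.IsLimit.lift' hl x h
  have := hx (equalizer.ι f g) inferInstance s hs
  exact eq_of_epi_equalizer

theorem IsMinimalArrow.finrank_le [Preadditive E] [Linear k E] {G : C ⥤ E}
    [PreservesFiniteLimits G] [G.Additive] [G.Linear k] {T : E} {X : C} {x : T ⟶ G.obj X} (hx : IsMinimalArrow G x) (I : C)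
    [Module.Finite k (T ⟶ G.obj I)] :
    Module.finrank k (X ⟶ I) ≤ Module.finrank k (T ⟶ G.obj I) :=
  LinearMap.finrank_le_finrank_of_injective
    (f := (Linear.leftComp k (G.obj I) x).comp (G.mapLinearMap k))
    fun f g h => hx.eq_of_comp_eq f g h

variable [∀ X Y : C, Module.Finite k (X ⟶ Y)]

theorem finrank_le_of_mono {S X : C} (I : C) [Injective I] (i : S ⟶ X) [Mono i] :
    Module.finrank k (S ⟶ I) ≤ Module.finrank k (X ⟶ I) :=
  LinearMap.finrank_le_finrank_of_surjective (f := Linear.leftComp k I i)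
    fun g => ⟨Injective.factorThru g i, Injective.comp_factorThru g i⟩

theorem isIso_of_finrank_le {S X : C} (I : C) [Injective I] (hI : IsCoseparator I) (i : S ⟶ X)
    [Mono i] (h : Module.finrank k (X ⟶ I) ≤ Module.finrank k (S ⟶ I)) : IsIso i := by
  have hs : Function.Surjective (Linear.leftComp k I i) :=
    fun g => ⟨Injective.factorThru g i, Injective.comp_factorThru g i⟩
  have hinj : Function.Injective (Linear.leftComp k I i) :=
    (LinearMap.injective_iff_surjective_of_finrank_eq_finrank
      (le_antisymm h (finrank_le_of_mono k I i))).2 hs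
  have : Epi i := ⟨fun {Z} a b hab => by
    refine (isCoseparator_def I).1 hI _ _ fun q => hinj ?_
    simp [← Category.assoc, hab]⟩
  exact isIso_of_mono_of_epi i

theorem isIso_of_epi_of_finrank_le {Z X : C} (I : C) (hI : IsCoseparator I) (p : Z ⟶ X)
    [Epi p] (h : Module.finrank k (Z ⟶ I) ≤ Module.finrank k (X ⟶ I)) : IsIso p := by
  have hi : Function.Injective (Linear.leftComp k I p) := fun a b hab => (cancel_epi p).1 hab
  have hsurj : Function.Surjective (Linear.leftComp k I p) :=
    (LinearMap.injective_iff_surjective_of_finrank_eq_finrank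
      (le_antisymm (LinearMap.finrank_le_finrank_of_injective hi) h)).1 hi
  have : Mono p := ⟨fun {W} a b hab => by
    refine (isCoseparator_def I).1 hI _ _ fun q => ?_
    obtain ⟨r, rfl⟩ := hsurj q
    simp only [Linear.leftComp_apply, ← Category.assoc, hab]⟩
  exact isIso_of_mono_of_epi p

theorem exists_minimalArrow (I : C) [Injective I] (hI : IsCoseparator I) (G : C ⥤ E) {T : E} :
    ∀ (n : ℕ) {X : C} (x : T ⟶ G.obj X), Module.finrank k (X ⟶ I) = n →
    ∃ (S : C) (i : S ⟶ X) (s : T ⟶ G.obj S), s ≫ G.map i = x ∧ IsMinimalArrow G s := by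
  intro n
  induction n using Nat.strong_induction_on with
  | _ n ih =>
    intro X x hn
    by_cases hx : IsMinimalArrow G x
    · exact ⟨X, 𝟙 X, x, by simp, hx⟩
    · simp only [IsMinimalArrow, not_forall] at hx
      obtain ⟨S, i, hi, s, hs, hni⟩ := hx
      have hlt : Module.finrank k (S ⟶ I) < n := by
        by_contra hle
        exact hni (isIso_of_finrank_le k I hI i (by omega))
      obtain ⟨S', i', s', hs', hm⟩ := ih _ hlt s rfl
      exact ⟨S', i' ≫ i, s', by rw [G.map_comp, ← Category.assoc, hs', hs], hm⟩

/-- A `k`-linear left exact functor `G` with finite-dimensional spaces `Hom(T, G X)`, defined on a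
`k`-linear abelian category with finite-dimensional Hom spaces and an injective coseparator, has a
left adjoint. -/
theorem isRightAdjoint_of_finite [Preadditive E] [Linear k E] (I : C) [Injective I]
    (hI : IsCoseparator I) (G : C ⥤ E) [PreservesFiniteLimits G] [G.Additive] [G.Linear k]
    (hfin : ∀ (T : E) (X : C), Module.Finite k (T ⟶ G.obj X)) : G.IsRightAdjoint := by
  have main : ∀ T : E, ∃ (X : C) (x : T ⟶ G.obj X), IsMinimalArrow G x ∧
      ∀ (Y : C) (y : T ⟶ G.obj Y), ∃ f : X ⟶ Y, x ≫ G.map f = y := by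
    intro T
    have := hfin T I
    let p : ℕ → Prop := fun n => ∃ (X : C) (x : T ⟶ G.obj X), IsMinimalArrow G x ∧
      Module.finrank k (X ⟶ I) = n
    have hp0 : ∃ n, p n := by
      obtain ⟨S, _, s, _, hs⟩ := exists_minimalArrow k I hI G _ (0 : T ⟶ G.obj I) rfl
      exact ⟨_, S, s, hs, rfl⟩
    have hpb : ∀ n, p n → n ≤ Module.finrank k (T ⟶ G.obj I) := by
      rintro n ⟨X, x, hx, rfl⟩
      exact hx.finrank_le k I
    classical
    obtain ⟨n0, hn0⟩ := hp0
    obtain ⟨X, x, hx, hd⟩ := Nat.findGreatest_spec (P := p) (hpb n0 hn0) hn0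
    refine ⟨X, x, hx, fun Y y => ?_⟩
    obtain ⟨Z, i, z, hz, hm⟩ := exists_minimalArrow k I hI G _
      (x ≫ G.map (biprod.inl : X ⟶ X ⊞ Y) + y ≫ G.map (biprod.inr : Y ⟶ X ⊞ Y)) rfl
    have hz1 : z ≫ G.map (i ≫ biprod.fst) = x := by
      rw [G.map_comp, ← Category.assoc, hz, Preadditive.add_comp, Category.assoc, Category.assoc,
        ← G.map_comp, ← G.map_comp]
      simp
    have hz2 : z ≫ G.map (i ≫ biprod.snd) = y := by
      rw [G.map_comp, ← Category.assoc, hz, Preadditive.add_comp, Category.assoc, Category.assoc,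
        ← G.map_comp, ← G.map_comp]
      simp
    have hepi : Epi (i ≫ (biprod.fst : X ⊞ Y ⟶ X)) := by
      have := hx (image.ι (i ≫ (biprod.fst : X ⊞ Y ⟶ X))) inferInstance
        (z ≫ G.map (factorThruImage _)) (by
          rw [Category.assoc, ← G.map_comp, image.fac, hz1])
      rw [← image.fac (i ≫ (biprod.fst : X ⊞ Y ⟶ X))]
      infer_instance
    have hle : Module.finrank k (Z ⟶ I) ≤ Module.finrank k (X ⟶ I) := by
      rw [hd]
      exact Nat.le_findGreatest (hm.finrank_le k I) ⟨Z, z, hm, rfl⟩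
    have := isIso_of_epi_of_finrank_le k I hI (i ≫ (biprod.fst : X ⊞ Y ⟶ X)) hle
    refine ⟨inv (i ≫ (biprod.fst : X ⊞ Y ⟶ X)) ≫ i ≫ biprod.snd, ?_⟩
    conv_lhs => rw [← hz1]
    rw [Category.assoc, ← G.map_comp, IsIso.hom_inv_id_assoc, hz2]
  choose X x hx hex using main
  let e : ∀ (T : E) (Y : C), (X T ⟶ Y) ≃ (T ⟶ G.obj Y) := fun T Y =>
    Equiv.ofBijective (fun f => x T ≫ G.map f)
      ⟨fun f g h => (hx T).eq_of_comp_eq f g h, fun y => hex T Y y⟩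
  exact (Adjunction.adjunctionOfEquivLeft e (fun T Y Y' g h => by
    change x T ≫ G.map (h ≫ g) = (x T ≫ G.map h) ≫ G.map g
    simp)).isRightAdjoint

end AdjointFunctor

section Rex

variable (k : Type w) [Field k] (C : Type u₁) [Category.{v₁} C] [Abelian C] [Linear k C]
  (D : Type u₂) [Category.{v₂} D] [Abelian D] [Linear k D]

/-- The property of being a `k`-linear right exact functor. -/
def isRex : ObjectProperty (C ⥤ D) :=
  fun T => T.Additive ∧ T.Linear k ∧ PreservesFiniteColimits T

/-- The category `Rex(C, D)` of `k`-linear right exact functors and natural transformations. -/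
abbrev Rex := (isRex k C D).FullSubcategory

variable {C D}

theorem rex_finite_hom [IsFiniteAbelian k C] [IsFiniteAbelian k D] (T S : Rex k C D) :
    Module.Finite k (T ⟶ S) := by
  obtain ⟨P, -, hP⟩ := exists_projective_separator k C
  obtain ⟨_, _, _⟩ := T.property
  let f : (T ⟶ S) →ₗ[k] (T.obj.obj P ⟶ S.obj.obj P) :=
    { toFun := fun t => t.hom.app P
      map_add' := fun _ _ => rfl
      map_smul' := fun _ _ => rfl }
  refine Module.Finite.of_injective f ?_
  rw [injective_iff_map_eq_zero]
  intro t ht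
  replace ht : t.hom.app P = 0 := ht
  ext X
  change t.hom.app X = 0
  let b := Module.finBasis k (P ⟶ X)
  let q : (⨁ fun _ : Fin (Module.finrank k (P ⟶ X)) => P) ⟶ X := biproduct.desc b
  have hq : Epi q := by
    refine ⟨fun {Z} u v huv => (isSeparator_def P).1 hP _ _ fun r => ?_⟩
    have hb : ∀ i, b i ≫ u = b i ≫ v := fun i => by
      simpa [q] using biproduct.ι _ i ≫= huv
    have hl : Linear.rightComp k P u = Linear.rightComp k P v := b.ext hb
    exact LinearMap.congr_fun hl r
  have h0 : t.hom.app (⨁ fun _ : Fin (Module.finrank k (P ⟶ X)) => P) = 0 := by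
    rw [← Category.id_comp (t.hom.app _), ← T.obj.map_id, ← biproduct.total, T.obj.map_sum,
      Preadditive.sum_comp]
    refine Finset.sum_eq_zero fun i _ => ?_
    rw [T.obj.map_comp, Category.assoc, t.hom.naturality, ht]
    simp
  rw [← cancel_epi (T.obj.map q), t.hom.naturality, h0]
  simp

end Rex

section Cayley

variable (k : Type w) [Field k] (C : Type u) [Category.{v} C] [Abelian C] [Linear k C]
  [MonoidalCategory C] [MonoidalPreadditive C] [MonoidalLinear k C] [RigidCategory C]

/-- The Cayley functor `C ⥤ Rex(C, C)`, `X ↦ (-) ⊗ X`. -/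
def cayley : C ⥤ Rex k C C :=
  (isRex k C C).lift (tensoringRight C) fun X =>
    ⟨inferInstance, inferInstance, by
      have := (tensorRightAdjunction X (Xᘁ)).isLeftAdjoint
      exact inferInstanceAs (PreservesFiniteColimits (tensorRight X))⟩

instance : (cayley k C).Additive where
  map_add {X Y f g} := by
    ext Z
    exact MonoidalPreadditive.whiskerLeft_add f g

instance : (cayley k C).Linear k where
  map_smul {X Y} f r := by
    ext Z
    exact MonoidalLinear.whiskerLeft_smul Z r f

instance : PreservesFiniteLimits (cayley k C) := by
  have h : PreservesFiniteLimits (tensoringRight C) := ⟨fun J _ _ => by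
    refine preservesLimitsOfShape_of_evaluation _ _ fun X => ?_
    have := (tensorLeftAdjunction X (Xᘁ)).isRightAdjoint
    exact inferInstanceAs (PreservesLimitsOfShape J (tensorLeft X))⟩
  have h' : PreservesFiniteLimits (cayley k C ⋙ (isRex k C C).ι) := h
  exact ⟨fun J _ _ => preservesLimitsOfShape_of_reflects_of_preserves _ (isRex k C C).ι⟩

/-- The Cayley functor of a finite tensor category has a left adjoint. -/
instance cayley_isRightAdjoint [IsFiniteAbelian k C] : (cayley k C).IsRightAdjoint := by
  obtain ⟨P, _, hP⟩ := exists_projective_separator k C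
  have := injective_leftDual P
  exact isRightAdjoint_of_finite k (ᘁP) (isCoseparator_leftDual P hP) _
    fun T X => rex_finite_hom k T _

end Cayley

section Copower

variable (k : Type w) [Field k] {C : Type u} [Category.{v} C] [Abelian C] [Linear k C]

/-- The copower `V • M` of an object `M` by a finite-dimensional vector space `V`. It is
characterized by `Hom(V • M, N) ≅ Hom_k(V, Hom(M, N))`, see `copowerHomEquiv`. -/
def copower (V : Type*) [AddCommGroup V] [Module k V] (M : C) : C :=
  ⨁ fun _ : Fin (Module.finrank k V) => M

variable {V V' V'' : Type*} [AddCommGroup V] [Module k V] [Module.Finite k V]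
  [AddCommGroup V'] [Module k V'] [Module.Finite k V']
  [AddCommGroup V''] [Module k V''] [Module.Finite k V'']

/-- The universal linear map `V → Hom(M, V • M)`. -/
def copowerUnit (V : Type*) [AddCommGroup V] [Module k V] [Module.Finite k V] (M : C) :
    V →ₗ[k] (M ⟶ copower k V M) :=
  (Module.finBasis k V).constr k fun i => biproduct.ι (fun _ : Fin (Module.finrank k V) => M) i

theorem copowerUnit_basis (V : Type*) [AddCommGroup V] [Module k V] [Module.Finite k V] (M : C)
    (i : Fin (Module.finrank k V)) : copowerUnit k V M (Module.finBasis k V i) =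
      biproduct.ι (fun _ : Fin (Module.finrank k V) => M) i :=
  (Module.finBasis k V).constr_basis k _ i

/-- `Hom(V • M, N) ≅ Hom_k(V, Hom(M, N))`. -/
def copowerHomEquiv (V : Type*) [AddCommGroup V] [Module k V] [Module.Finite k V] (M N : C) :
    (copower k V M ⟶ N) ≃ₗ[k] (V →ₗ[k] (M ⟶ N)) where
  toFun g := (Linear.rightComp k M g).comp (copowerUnit k V M)
  map_add' g h := by ext v; simp
  map_smul' r g := by ext v; simp
  invFun φ := biproduct.desc fun i => φ (Module.finBasis k V i)
  left_inv g := by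
    refine biproduct.hom_ext' _ _ fun i => ?_
    rw [biproduct.ι_desc]
    exact congrArg (· ≫ g) (copowerUnit_basis k V M i)
  right_inv φ := by
    refine (Module.finBasis k V).ext fun i => ?_
    rw [LinearMap.comp_apply, copowerUnit_basis]
    exact biproduct.ι_desc _ _

/-- Functoriality of the copower `V • M` in `V`. -/
def copowerMap (φ : V →ₗ[k] V') (M : C) : copower k V M ⟶ copower k V' M :=
  (copowerHomEquiv k V M _).symm ((copowerUnit k V' M).comp φ)

theorem copowerHomEquiv_copowerMap_comp (φ : V →ₗ[k] V') {M N : C} (g : copower k V' M ⟶ N) :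
    copowerHomEquiv k V M N (copowerMap k φ M ≫ g) = (copowerHomEquiv k V' M N g).comp φ := by
  have h := (copowerHomEquiv k V M _).apply_symm_apply ((copowerUnit k V' M).comp φ)
  ext v
  have hv := LinearMap.congr_fun h v
  change copowerUnit k V M v ≫ copowerMap k φ M ≫ g = copowerUnit k V' M (φ v) ≫ g
  rw [← Category.assoc]
  exact congrArg (· ≫ g) hv

theorem copowerMap_id (M : C) : copowerMap k (LinearMap.id : V →ₗ[k] V) M = 𝟙 _ := by
  apply (copowerHomEquiv k V M _).injective
  rw [← Category.comp_id (copowerMap k _ M), copowerHomEquiv_copowerMap_comp]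
  rfl

theorem copowerMap_comp (φ : V →ₗ[k] V') (ψ : V' →ₗ[k] V'') (M : C) :
    copowerMap k (ψ.comp φ) M = copowerMap k φ M ≫ copowerMap k ψ M := by
  apply (copowerHomEquiv k V M _).injective
  rw [copowerHomEquiv_copowerMap_comp, ← Category.comp_id (copowerMap k _ M),
    copowerHomEquiv_copowerMap_comp, ← Category.comp_id (copowerMap k ψ M),
    copowerHomEquiv_copowerMap_comp]
  rfl

theorem copowerMap_add (φ ψ : V →ₗ[k] V') (M : C) :
    copowerMap k (φ + ψ) M = copowerMap k φ M + copowerMap k ψ M := by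
  simp [copowerMap, LinearMap.comp_add]

theorem copowerMap_smul (r : k) (φ : V →ₗ[k] V') (M : C) :
    copowerMap k (r • φ) M = r • copowerMap k φ M := by
  simp [copowerMap, LinearMap.comp_smul]

end Copower

section ModularObject

variable (k : Type w) [Field k] (C : Type u) [Category.{v} C] [Abelian C] [Linear k C]
  [MonoidalCategory C] [IsFiniteAbelian k C]

/-- The functor `X ↦ Hom(X, 1)^* • 1`. -/
def trivFunctor : C ⥤ C where
  obj X := copower k (Module.Dual k (X ⟶ 𝟙_ C)) (𝟙_ C)
  map f := copowerMap k (Linear.leftComp k (𝟙_ C) f).dualMap (𝟙_ C)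
  map_id X := by
    rw [← copowerMap_id]
    congr 1
    ext ξ g
    simp
  map_comp f g := by
    rw [← copowerMap_comp]
    congr 1
    ext ξ h
    simp

instance : (trivFunctor k C).Additive where
  map_add {X Y f g} := by
    refine Eq.trans (congrArg (fun φ => copowerMap k φ (𝟙_ C)) ?_) (copowerMap_add k _ _ _)
    ext ξ h
    simp

instance : (trivFunctor k C).Linear k where
  map_smul {X Y} f r := by
    refine Eq.trans (congrArg (fun φ => copowerMap k φ (𝟙_ C)) ?_) (copowerMap_smul k r _ _)
    ext ξ h
    simp

/-- `Hom_k(Hom(X, 1)^*, W) ≅ Hom(X, W • 1)`. -/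
def dualHomEquiv (X : C) (W : Type*) [AddCommGroup W] [Module k W] [Module.Finite k W] :
    (Module.Dual k (X ⟶ 𝟙_ C) →ₗ[k] W) ≃ (X ⟶ ⨁ fun _ : Fin (Module.finrank k W) => 𝟙_ C) where
  toFun φ := biproduct.lift fun i =>
    (Module.evalEquiv k (X ⟶ 𝟙_ C)).symm ((Module.finBasis k W).coord i ∘ₗ φ)
  invFun h := ∑ i, LinearMap.toSpanSingleton k W (Module.finBasis k W i) ∘ₗ
    Module.evalEquiv k (X ⟶ 𝟙_ C) (h ≫ biproduct.π _ i)
  left_inv φ := by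
    ext ξ
    simp only [biproduct.lift_π, LinearEquiv.apply_symm_apply, LinearMap.sum_apply,
      LinearMap.comp_apply, LinearMap.toSpanSingleton_apply, Module.Basis.coord_apply]
    exact (Module.finBasis k W).sum_repr (φ ξ)
  right_inv h := by
    refine biproduct.hom_ext _ _ fun i => ?_
    rw [biproduct.lift_π, LinearEquiv.symm_apply_eq]
    ext ξ
    simp [Finsupp.single_apply]

instance : (trivFunctor k C).IsLeftAdjoint :=
  (Adjunction.adjunctionOfEquivRight (F := trivFunctor k C)
    (fun X N => (copowerHomEquiv k (Module.Dual k (X ⟶ 𝟙_ C)) (𝟙_ C) N).toEquiv.trans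
      (dualHomEquiv k C X (𝟙_ C ⟶ N))) (by
    intro X' X Y f g
    refine biproduct.hom_ext _ _ fun i => ?_
    have h := copowerHomEquiv_copowerMap_comp k (Linear.leftComp k (𝟙_ C) f).dualMap g
    change dualHomEquiv k C X' (𝟙_ C ⟶ Y) (copowerHomEquiv k _ _ _ (copowerMap k _ _ ≫ g)) ≫ _ =
      (f ≫ dualHomEquiv k C X (𝟙_ C ⟶ Y) (copowerHomEquiv k _ _ _ g)) ≫ _
    rw [h, Category.assoc]
    simp only [dualHomEquiv, Equiv.coe_fn_mk, biproduct.lift_π]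
    rw [LinearEquiv.symm_apply_eq]
    ext ξ
    obtain ⟨t, ht⟩ := (Module.evalEquiv k (X ⟶ 𝟙_ C)).surjective
      ((Module.finBasis k (𝟙_ C ⟶ Y)).coord i ∘ₗ copowerHomEquiv k _ (𝟙_ C) Y g)
    rw [← LinearMap.comp_assoc, ← ht, LinearEquiv.symm_apply_apply]
    rfl)).isLeftAdjoint

/-- The object `J = Hom(-, 1)^* • 1` of `Rex(C, C)`. -/
def trivRex : Rex k C C := ⟨trivFunctor k C, inferInstance, inferInstance, inferInstance⟩

/-- The modular object: the image of `J = Hom(-, 1)^* • 1` under a left adjoint of the Cayley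
functor. -/
def modularObject [MonoidalPreadditive C] [MonoidalLinear k C] [RigidCategory C] : C :=
  (cayley k C).leftAdjoint.obj (trivRex k C)

end ModularObject

section RelativeModularObject

/-- Invertible objects of a monoidal category. -/
def IsInvertibleObject {C : Type u} [Category.{v} C] [MonoidalCategory C] (X : C) : Prop :=
  ∃ Y : C, Nonempty (X ⊗ Y ≅ 𝟙_ C) ∧ Nonempty (Y ⊗ X ≅ 𝟙_ C)

variable {C : Type u₁} [Category.{v₁} C] {D : Type u₂} [Category.{v₂} D]

/-- `χ` is a relative modular object of `F`: `R ≅ L(- ⊗ χ)`, where `L ⊣ F ⊣ R`. -/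
def IsRelativeModularObject [MonoidalCategory D] (F : C ⥤ D) (χ : D) : Prop :=
  ∃ (L R : D ⥤ C) (_ : L ⊣ F) (_ : F ⊣ R), Nonempty (R ≅ tensorRight χ ⋙ L)

/-- At least one of the following seven conditions holds, where `L ⊣ F ⊣ R`:
(1) `L` has a left adjoint; (2) `R` has a right adjoint; (3) `R ≅ L(- ⊗ χ)` for some object `χ`;
(4) `L` is exact; (5) `R` is exact; (6) `F` preserves projective objects;
(7) `F` sends some projective generator to a projective object. -/
def RelativeModularCondition [MonoidalCategory D] (F : C ⥤ D) : Prop :=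
  (∃ (L : D ⥤ C) (_ : L ⊣ F), L.IsRightAdjoint) ∨
  (∃ (R : D ⥤ C) (_ : F ⊣ R), R.IsLeftAdjoint) ∨
  (∃ χ : D, IsRelativeModularObject F χ) ∨
  (∃ (L : D ⥤ C) (_ : L ⊣ F), PreservesFiniteLimits L ∧ PreservesFiniteColimits L) ∨
  (∃ (R : D ⥤ C) (_ : F ⊣ R), PreservesFiniteLimits R ∧ PreservesFiniteColimits R) ∨
  (∀ P : C, Projective P → Projective (F.obj P)) ∨
  (∃ P : C, Projective P ∧ IsSeparator P ∧ Projective (F.obj P))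

end RelativeModularObject

end FinTensor

end

/-! The isomorphisms come from Yoneda. By definition `α_C` corepresents the functor sending `V` to
the natural families of linear maps `Hom(X, 1)^* → Hom(1, X ⊗ V)`. Such families can be moved along
an adjunction `U ⊣ K`: precomposing the target with `U` amounts to precomposing the source with `K`
(`DualFamily.precompEquiv`).

Let `R ≅ L(- ⊗ χ)`. A morphism `F α_C ⟶ V` is a morphism `α_C ⟶ R V`, hence a family with values in
`Hom(1, X ⊗ R V) ≅ Hom(1, F X ⊗ V)`, by the projection formula. Moving `F` across `F ⊣ R` gives
families `Hom(R Y, 1)^* → Hom(1, Y ⊗ V)`, and `Hom(R Y, 1) ≅ Hom(L(Y ⊗ χ), 1) ≅ Hom(Y ⊗ χ, 1)`.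
Duality in `D` gives the same families for `χ ⊗ α_D`, so `χ ⊗ α_D ≅ F α_C`.

The same computation for `α_D ⊗ P` agrees with that for `P ⊗ α_D` as soon as one object is both a
left and a right dual of `P`. This holds for `P = χ`: the dual `c` of `χ` represents `Hom(R(-), 1)`,
and `R` commutes with double duals because `F` preserves duals, so `c` is isomorphic to its double
dual (`nonempty_iso_doubleLeftDual`).

For existence, each condition either provides `χ` or forces `R` to have a right adjoint. Let `c` be
the value of that adjoint at `1`. The projection formula shows `R ⊣ F(-) ⊗ c`, and `L(- ⊗ ᘁc)` has
the same right adjoint. The invertible case is then formal cancellation. -/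

noncomputable section

namespace FinTensor

/-! ### Transposes along arbitrary exact pairings -/

section Mates

variable {C : Type u₁} [Category.{v₁} C] [MonoidalCategory C]

/-- An arbitrary pairing is allowed because `F` sends the chosen dual of `X` to a dual of `F X`, but
not to the chosen one. -/
theorem evalRight_bijective_of_exactPairing (P X X' : C) [ExactPairing X X'] :
    Function.Bijective (fun g : P ⟶ X' => g ▷ X ≫ ε_ X X') := by
  let _ : HasRightDual X := ⟨X'⟩
  rw [← (tensorRightHomEquiv P X X' (𝟙_ C)).comp_bijective]
  have : (tensorRightHomEquiv P X X' (𝟙_ C)) ∘ (fun f : P ⟶ X' => f ▷ X ≫ ε_ X X') =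
      (λ_ X').symm.homToEquiv := by
    ext f
    exact tensorRightHomEquiv_whiskerRight_comp_evaluation (X := X) f
  rw [this]
  exact Equiv.bijective _

/-- Morphisms `f : X ⟶ Y` and `g : Y' ⟶ X'` between the members of two exact pairings are mates
if they are transposes of each other. -/
def IsMate {X X' Y Y' : C} [ExactPairing X X'] [ExactPairing Y Y'] (f : X ⟶ Y) (g : Y' ⟶ X') :
    Prop :=
  Y' ◁ f ≫ ε_ Y Y' = g ▷ X ≫ ε_ X X'

section

variable {X X' Y Y' Z Z' : C} [ExactPairing X X'] [ExactPairing Y Y'] [ExactPairing Z Z']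

theorem IsMate.comp {f : X ⟶ Y} {g : Y' ⟶ X'} {f₂ : Y ⟶ Z} {g₂ : Z' ⟶ Y'} (h : IsMate f g)
    (h₂ : IsMate f₂ g₂) : IsMate (f ≫ f₂) (g₂ ≫ g) := by
  unfold IsMate at *
  rw [MonoidalCategory.whiskerLeft_comp, Category.assoc, h₂, whisker_exchange_assoc, h,
    comp_whiskerRight, Category.assoc]

theorem IsMate.right_unique {f : X ⟶ Y} {g g' : Y' ⟶ X'} (h : IsMate f g) (h₂ : IsMate f g') :
    g = g' :=
  (evalRight_bijective_of_exactPairing Y' X X').1 (h.symm.trans h₂)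

/-- Transposition of morphisms along exact pairings. -/
def mateEquiv (X X' Y Y' : C) [ExactPairing X X'] [ExactPairing Y Y'] : (X ⟶ Y) ≃ (Y' ⟶ X') :=
  (Equiv.ofBijective _ (evalLeft_bijective Y' X Y)).trans
    (Equiv.ofBijective _ (evalRight_bijective_of_exactPairing Y' X X')).symm

theorem isMate_mateEquiv (f : X ⟶ Y) : IsMate f (mateEquiv X X' Y Y' f) :=
  ((Equiv.ofBijective _ (evalRight_bijective_of_exactPairing Y' X X')).apply_symm_apply
    (Y' ◁ f ≫ ε_ Y Y')).symm

theorem isMate_mateEquiv_symm (g : Y' ⟶ X') : IsMate ((mateEquiv X X' Y Y').symm g) g := by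
  simpa using isMate_mateEquiv (X' := X') (Y' := Y') ((mateEquiv X X' Y Y').symm g)

theorem IsMate.mateEquiv_eq {f : X ⟶ Y} {g : Y' ⟶ X'} (h : IsMate f g) :
    mateEquiv X X' Y Y' f = g :=
  (isMate_mateEquiv f).right_unique h

theorem isMate_id (X X' : C) [ExactPairing X X'] : IsMate (𝟙 X) (𝟙 X') := by
  simp [IsMate]

/-- Once the given pairings are declared to be the chosen duals, uniqueness of mates makes `g` the
transpose `fᘁ`, which is compatible with coevaluations. -/
theorem IsMate.coevaluation_comp {f : X ⟶ Y} {g : Y' ⟶ X'} (h : IsMate f g) :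
    η_ X X' ≫ f ▷ X' = η_ Y Y' ≫ Y ◁ g := by
  let _ : HasRightDual X := ⟨X'⟩
  let _ : HasRightDual Y := ⟨Y'⟩
  have hg : g = fᘁ := h.right_unique (rightAdjointMate_comp_evaluation f).symm
  rw [hg]
  exact (coevaluation_comp_rightAdjointMate f).symm

theorem isMate_rightAdjointMate [RightRigidCategory C] {X Y : C} (f : X ⟶ Y) : IsMate f (fᘁ) :=
  (rightAdjointMate_comp_evaluation f).symm

/-- The bijection `Hom(Y' ⊗ A, Z) ≃ Hom(A, Y ⊗ Z)` is natural in the exact pairing. -/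
theorem IsMate.tensorLeftHomEquiv_comp {f : X ⟶ Y} {g : Y' ⟶ X'} (h : IsMate f g) {A Z : C}
    (a : X' ⊗ A ⟶ Z) : tensorLeftHomEquiv A X X' Z a ≫ f ▷ Z =
      tensorLeftHomEquiv A Y Y' Z (g ▷ A ≫ a) := by
  simp only [tensorLeftHomEquiv, Equiv.coe_fn_mk, Category.assoc]
  rw [whisker_exchange, ← associator_naturality_left_assoc, ← comp_whiskerRight_assoc,
    h.coevaluation_comp]
  simp

end

section MonoidalFunctor

open Functor.LaxMonoidal Functor.OplaxMonoidal Functor.Monoidal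

variable {D : Type u₂} [Category.{v₂} D] [MonoidalCategory D] (F : C ⥤ D) [F.Monoidal]

/-- A monoidal functor preserves exact pairings. -/
@[reducible]
def exactPairingMap (X X' : C) [ExactPairing X X'] : ExactPairing (F.obj X) (F.obj X') where
  coevaluation' := ε F ≫ F.map (η_ X X') ≫ δ F X X'
  evaluation' := μ F X' X ≫ F.map (ε_ X X') ≫ η F
  coevaluation_evaluation' := by
    have h := congrArg F.map (ExactPairing.coevaluation_evaluation X X')
    simp only [F.map_comp, map_whiskerLeft, map_whiskerRight, map_associator_inv,
      map_rightUnitor, map_leftUnitor_inv, Category.assoc, μ_δ_assoc] at h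
    -- The image of the zigzag identity begins and ends at `F` of a product with the unit; the
    -- structure maps of `F` carry these ends to the ones required in `D`.
    have h2 := (F.obj X' ◁ ε F ≫ μ F X' (𝟙_ C)) ≫= h =≫ (δ F (𝟙_ C) X' ≫ η F ▷ F.obj X')
    simp only [Category.assoc, μ_δ_assoc] at h2
    simpa using h2
  evaluation_coevaluation' := by
    have h := congrArg F.map (ExactPairing.evaluation_coevaluation X X')
    simp only [F.map_comp, map_whiskerLeft, map_whiskerRight, map_associator,
      map_leftUnitor, map_rightUnitor_inv, Category.assoc, μ_δ_assoc] at h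
    have h2 := (ε F ▷ F.obj X ≫ μ F (𝟙_ C) X) ≫= h =≫ (δ F X (𝟙_ C) ≫ F.obj X ◁ η F)
    simp only [Category.assoc, μ_δ_assoc] at h2
    simpa using h2

theorem IsMate.map {X X' Y Y' : C} [ExactPairing X X'] [ExactPairing Y Y'] {f : X ⟶ Y}
    {g : Y' ⟶ X'} (h : IsMate f g) :
    letI := exactPairingMap F X X'
    letI := exactPairingMap F Y Y'
    IsMate (F.map f) (F.map g) := by
  change F.obj Y' ◁ F.map f ≫ μ F Y' Y ≫ F.map (ε_ Y Y') ≫ η F =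
    F.map g ▷ F.obj X ≫ μ F X' X ≫ F.map (ε_ X X') ≫ η F
  rw [μ_natural_right_assoc, ← F.map_comp_assoc, h, F.map_comp_assoc, μ_natural_left_assoc]

end MonoidalFunctor

end Mates

theorem nonempty_iso_of_homEquiv {C : Type u} [Category.{v} C] {X Y : C}
    (e : ∀ Z, (X ⟶ Z) ≃ (Y ⟶ Z))
    (h : ∀ {Z Z' : C} (f : X ⟶ Z) (g : Z ⟶ Z'), e Z' (f ≫ g) = e Z f ≫ g) :
    Nonempty (X ≅ Y) :=
  ⟨Coyoneda.ext X Y (fun {Z} => e Z) (fun {Z} => (e Z).symm) (fun f => by simp)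
    (fun f => by simp) fun f g => by rw [Equiv.symm_apply_eq, h, Equiv.apply_symm_apply]⟩

/-! ### Natural families of linear maps and adjunctions -/

section DualFamily

/-- Natural families of linear maps `Hom(G X, M)^* → Hom(N, H X)`. -/
@[ext]
structure DualFamily (k : Type w) [Field k] {E : Type*} [Category* E] {A : Type*} [Category* A]
    [Preadditive A] [Linear k A] {B : Type*} [Category* B] [Preadditive B] [Linear k B]
    (G : E ⥤ A) (M : A) (N : B) (H : E ⥤ B) where
  /-- The components of the family. -/
  app (X : E) : Module.Dual k (G.obj X ⟶ M) →ₗ[k] (N ⟶ H.obj X)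
  naturality {X Y : E} (f : X ⟶ Y) (ξ : Module.Dual k (G.obj X ⟶ M)) :
    app X ξ ≫ H.map f = app Y ((Linear.leftComp k M (G.map f)).dualMap ξ)

namespace DualFamily

variable {k : Type w} [Field k] {E : Type*} [Category* E] {E' : Type*} [Category* E']
  {A : Type*} [Category* A] [Preadditive A] [Linear k A]
  {A' : Type*} [Category* A'] [Preadditive A'] [Linear k A']
  {B' : Type*} [Category* B'] [Preadditive B'] [Linear k B']
  {B : Type*} [Category* B] [Preadditive B] [Linear k B]

/-- Composition of a family with a natural transformation. -/
def postcomp {G : E ⥤ A} {M : A} {N : B} {H H' : E ⥤ B} (τ : H ⟶ H')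
    (φ : DualFamily k G M N H) : DualFamily k G M N H' where
  app X := (Linear.rightComp k N (τ.app X)).comp (φ.app X)
  naturality f ξ := by
    have := φ.naturality f ξ
    simp only [LinearMap.comp_apply, Linear.rightComp_apply, Category.assoc, ← this,
      τ.naturality]

/-- Replacing the spaces `Hom(G X, M)` by naturally isomorphic ones. -/
def congrLeft {G : E ⥤ A} {M : A} {G' : E ⥤ A'} {M' : A'} (N : B) (H : E ⥤ B)
    (a : ∀ X, (G.obj X ⟶ M) ≃ₗ[k] (G'.obj X ⟶ M'))
    (ha : ∀ {X Y : E} (f : X ⟶ Y) (g : G.obj Y ⟶ M), a X (G.map f ≫ g) = G'.map f ≫ a Y g) :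
    DualFamily k G M N H ≃ DualFamily k G' M' N H where
  toFun φ :=
    { app X := (φ.app X).comp (a X).toLinearMap.dualMap
      naturality f ξ := by
        refine (φ.naturality f _).trans (congrArg (φ.app _) ?_)
        ext g
        exact congrArg ξ (ha f g) }
  invFun φ :=
    { app X := (φ.app X).comp (a X).symm.toLinearMap.dualMap
      naturality f ξ := by
        refine (φ.naturality f _).trans (congrArg (φ.app _) ?_)
        ext g
        refine congrArg ξ ?_
        change (a _).symm (G'.map f ≫ g) = G.map f ≫ (a _).symm g
        rw [LinearEquiv.symm_apply_eq, ha, LinearEquiv.apply_symm_apply] }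
  left_inv φ := by
    ext X ξ
    refine congrArg (φ.app X) ?_
    ext g
    simp
  right_inv φ := by
    ext X ξ
    refine congrArg (φ.app X) ?_
    ext g
    simp

theorem congrLeft_postcomp {G : E ⥤ A} {M : A} {G' : E ⥤ A'} {M' : A'} {N : B} {H H' : E ⥤ B}
    (a : ∀ X, (G.obj X ⟶ M) ≃ₗ[k] (G'.obj X ⟶ M'))
    (ha : ∀ {X Y : E} (f : X ⟶ Y) (g : G.obj Y ⟶ M), a X (G.map f ≫ g) = G'.map f ≫ a Y g)
    (τ : H ⟶ H') (φ : DualFamily k G M N H) :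
    congrLeft N H' a ha (φ.postcomp τ) = (congrLeft N H a ha φ).postcomp τ :=
  rfl

/-- Replacing the spaces `Hom(N, H X)` by naturally isomorphic ones. -/
def congrRight (G : E ⥤ A) (M : A) {N : B} {H : E ⥤ B} {N' : B'} {H' : E ⥤ B'}
    (b : ∀ X, (N ⟶ H.obj X) ≃ₗ[k] (N' ⟶ H'.obj X))
    (hb : ∀ {X Y : E} (f : X ⟶ Y) (g : N ⟶ H.obj X), b Y (g ≫ H.map f) = b X g ≫ H'.map f) :
    DualFamily k G M N H ≃ DualFamily k G M N' H' where
  toFun φ :=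
    { app X := (b X).toLinearMap.comp (φ.app X)
      naturality f ξ := by
        simp only [LinearMap.comp_apply, LinearEquiv.coe_coe, ← hb, φ.naturality] }
  invFun φ :=
    { app X := (b X).symm.toLinearMap.comp (φ.app X)
      naturality f ξ := by
        simp only [LinearMap.comp_apply, LinearEquiv.coe_coe]
        rw [LinearEquiv.eq_symm_apply, hb, LinearEquiv.apply_symm_apply, φ.naturality] }
  left_inv φ := by
    ext X ξ
    simp
  right_inv φ := by
    ext X ξ
    simp

/-- Precomposition with a right adjoint is left adjoint to precomposition with a left adjoint. -/
def precompEquiv {U : E' ⥤ E} {K : E ⥤ E'} (adj : U ⊣ K) (G : E' ⥤ A) (M : A) (N : B)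
    (H : E ⥤ B) : DualFamily k (K ⋙ G) M N H ≃ DualFamily k G M N (U ⋙ H) where
  toFun φ :=
    { app X := (φ.app (U.obj X)).comp (Linear.leftComp k M (G.map (adj.unit.app X))).dualMap
      naturality f ξ := by
        refine (φ.naturality (U.map f) _).trans (congrArg (φ.app _) ?_)
        ext g
        refine congrArg ξ ?_
        change G.map _ ≫ G.map _ ≫ g = G.map _ ≫ G.map _ ≫ g
        rw [← G.map_comp_assoc, ← G.map_comp_assoc]
        congr 2
        exact (adj.unit.naturality f).symm }
  invFun φ :=
    { app Y := (Linear.rightComp k N (H.map (adj.counit.app Y))).comp (φ.app (K.obj Y))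
      naturality f ξ := by
        refine Eq.trans ?_ (congrArg (· ≫ H.map (adj.counit.app _)) (φ.naturality (K.map f) ξ))
        change (_ ≫ _) ≫ _ = (_ ≫ H.map (U.map (K.map f))) ≫ _
        rw [Category.assoc, Category.assoc, ← H.map_comp, ← H.map_comp]
        congr 2
        exact (adj.counit.naturality f).symm }
  -- Each round trip is naturality of the family at a counit or unit component, followed by a
  -- triangle identity.
  left_inv φ := by
    ext Y ξ
    refine (φ.naturality (adj.counit.app Y) _).trans (congrArg (φ.app Y) ?_)
    ext g
    refine congrArg ξ ?_
    change G.map _ ≫ G.map _ ≫ g = g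
    rw [← G.map_comp_assoc, adj.right_triangle_components]
    exact (congrArg (· ≫ g) (G.map_id _)).trans (Category.id_comp g)
  right_inv φ := by
    ext X ξ
    refine (congrArg (· ≫ H.map (adj.counit.app (U.obj X)))
      (φ.naturality (adj.unit.app X) ξ)).symm.trans ?_
    change (_ ≫ H.map (U.map _)) ≫ _ = _
    rw [Category.assoc, ← H.map_comp]
    refine (congrArg (fun t => φ.app X ξ ≫ H.map t) (adj.left_triangle_components X)).trans ?_
    rw [H.map_id]
    exact Category.comp_id _

theorem precompEquiv_postcomp {U : E' ⥤ E} {K : E ⥤ E'} (adj : U ⊣ K) {G : E' ⥤ A} {M : A}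
    {N : B} {H H' : E ⥤ B} (τ : H ⟶ H') (φ : DualFamily k (K ⋙ G) M N H) :
    precompEquiv adj G M N H' (φ.postcomp τ) =
      (precompEquiv adj G M N H φ).postcomp (Functor.whiskerLeft U τ) :=
  rfl

end DualFamily

end DualFamily

/-! ### The functor corepresented by the modular object -/

section ModularObject

variable (k : Type w) [Field k] {C : Type u} [Category.{v} C] [Abelian C] [Linear k C]
  [MonoidalCategory C] [MonoidalPreadditive C] [MonoidalLinear k C] [RigidCategory C]
  [IsFiniteAbelian k C]

/-- Natural transformations from `Hom(-, 1)^* • 1` to `(-) ⊗ V` are families of linear maps. -/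
def trivRexHomEquiv (V : C) : (trivRex k C ⟶ (cayley k C).obj V) ≃
    DualFamily k (𝟭 C) (𝟙_ C) (𝟙_ C) (tensorRight V) where
  toFun t :=
    { app X := copowerHomEquiv k (Module.Dual k (X ⟶ 𝟙_ C)) (𝟙_ C) (X ⊗ V) (t.hom.app X)
      naturality {X Y} f ξ := by
        have h := LinearMap.congr_fun (copowerHomEquiv_copowerMap_comp k
          (Linear.leftComp k (𝟙_ C) f).dualMap (t.hom.app Y)) ξ
        refine Eq.trans ?_ h
        have hn : copowerMap k (Linear.leftComp k (𝟙_ C) f).dualMap (𝟙_ C) ≫ t.hom.app Y =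
          t.hom.app X ≫ f ▷ V := t.hom.naturality f
        rw [hn]
        exact Category.assoc _ _ _ }
  invFun φ := ObjectProperty.homMk
    { app X := (copowerHomEquiv k (Module.Dual k (X ⟶ 𝟙_ C)) (𝟙_ C) (X ⊗ V)).symm (φ.app X)
      naturality X Y f := by
        apply (copowerHomEquiv k _ _ _).injective
        refine (copowerHomEquiv_copowerMap_comp k (Linear.leftComp k (𝟙_ C) f).dualMap _).trans ?_
        ext ξ
        refine (LinearMap.congr_fun ((copowerHomEquiv k (Module.Dual k (Y ⟶ 𝟙_ C)) (𝟙_ C)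
          (Y ⊗ V)).apply_symm_apply (φ.app Y)) _).trans ?_
        refine (φ.naturality f ξ).symm.trans ?_
        have h := LinearMap.congr_fun ((copowerHomEquiv k (Module.Dual k (X ⟶ 𝟙_ C)) (𝟙_ C)
          (X ⊗ V)).apply_symm_apply (φ.app X)) ξ
        refine (congrArg (· ≫ f ▷ V) h.symm).trans ?_
        exact Category.assoc _ _ _ }
  left_inv t := by
    ext X
    exact LinearEquiv.symm_apply_apply _ _
  right_inv φ := by
    apply DualFamily.ext
    ext1 X
    exact LinearEquiv.apply_symm_apply _ _

/-- The universal property of the modular object. -/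
def modularObjectHomEquiv (V : C) : (modularObject k C ⟶ V) ≃
    DualFamily k (𝟭 C) (𝟙_ C) (𝟙_ C) (tensorRight V) :=
  ((Adjunction.ofIsRightAdjoint (cayley k C)).homEquiv (trivRex k C) V).trans
    (trivRexHomEquiv k V)

theorem modularObjectHomEquiv_comp {V W : C} (f : modularObject k C ⟶ V) (g : V ⟶ W) :
    modularObjectHomEquiv k W (f ≫ g) =
      (modularObjectHomEquiv k V f).postcomp ((tensoringRight C).map g) := by
  have h := (Adjunction.ofIsRightAdjoint (cayley k C)).homEquiv_naturality_right
    (X := trivRex k C) f g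
  refine (congrArg (trivRexHomEquiv k W) h).trans ?_
  ext X ξ
  exact (Category.assoc _ _ _).symm

end ModularObject

/-- `T` needs no functor laws: compatibility of both bijections with `act` already makes the
composite bijection natural. -/
theorem nonempty_iso_of_equivs {C : Type u} [Category.{v} C] {X Y : C} {T : C → Type*}
    (act : ∀ {Z Z' : C}, (Z ⟶ Z') → T Z → T Z')
    (e : ∀ Z, (X ⟶ Z) ≃ T Z) (e' : ∀ Z, (Y ⟶ Z) ≃ T Z)
    (h : ∀ {Z Z' : C} (f : X ⟶ Z) (g : Z ⟶ Z'), e Z' (f ≫ g) = act g (e Z f))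
    (h' : ∀ {Z Z' : C} (f : Y ⟶ Z) (g : Z ⟶ Z'), e' Z' (f ≫ g) = act g (e' Z f)) :
    Nonempty (X ≅ Y) :=
  nonempty_iso_of_homEquiv (fun Z => (e Z).trans (e' Z).symm) fun f g => by
    simp only [Equiv.trans_apply]
    rw [Equiv.symm_apply_eq, h, h', Equiv.apply_symm_apply]

/-! ### Linear Hom isomorphisms from duality -/

section HomEquiv

variable {C : Type u} [Category.{v} C] [MonoidalCategory C]

theorem tensorRightHomEquiv_naturality_left {X X' Y Y' Z : C} [ExactPairing Y Y'] (f : X ⟶ X')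
    (g : X' ⊗ Y ⟶ Z) :
    tensorRightHomEquiv X Y Y' Z (f ▷ Y ≫ g) = f ≫ tensorRightHomEquiv X' Y Y' Z g :=
  (Equiv.eq_symm_apply _).1 (by rw [tensorRightHomEquiv_symm_naturality, Equiv.symm_apply_apply])

theorem tensorLeftHomEquiv_naturality_left {X X' Y Y' Z : C} [ExactPairing Y Y'] (f : X ⟶ X')
    (g : Y' ⊗ X' ⟶ Z) :
    tensorLeftHomEquiv X Y Y' Z (Y' ◁ f ≫ g) = f ≫ tensorLeftHomEquiv X' Y Y' Z g :=
  (Equiv.eq_symm_apply _).1 (by rw [tensorLeftHomEquiv_symm_naturality, Equiv.symm_apply_apply])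

end HomEquiv

section LinearEquivs

variable (k : Type w) [Field k] {C : Type u} [Category.{v} C] [Preadditive C] [Linear k C]

/-- The linear isomorphism `Hom(N, X) ≅ Hom(N, Y)` induced by an isomorphism `X ≅ Y`. -/
@[simps]
def homToLinearEquiv (N : C) {X Y : C} (i : X ≅ Y) : (N ⟶ X) ≃ₗ[k] (N ⟶ Y) where
  toFun f := f ≫ i.hom
  invFun f := f ≫ i.inv
  map_add' f g := by simp
  map_smul' r f := by simp
  left_inv f := by simp
  right_inv f := by simp

/-- The linear isomorphism `Hom(X, N) ≅ Hom(Y, N)` induced by an isomorphism `X ≅ Y`. -/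
@[simps]
def homFromLinearEquiv (N : C) {X Y : C} (i : X ≅ Y) : (X ⟶ N) ≃ₗ[k] (Y ⟶ N) where
  toFun f := i.inv ≫ f
  invFun f := i.hom ≫ f
  map_add' f g := by simp
  map_smul' r f := by simp
  left_inv f := by simp
  right_inv f := by simp

variable [MonoidalCategory C] [MonoidalPreadditive C] [MonoidalLinear k C]

/-- The linear version of `tensorRightHomEquiv`. -/
def tensorRightHomLinearEquiv (X Y Y' Z : C) [ExactPairing Y Y'] :
    (X ⊗ Y ⟶ Z) ≃ₗ[k] (X ⟶ Z ⊗ Y') where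
  toEquiv := tensorRightHomEquiv X Y Y' Z
  map_add' f g := by simp [tensorRightHomEquiv]
  map_smul' r f := by simp [tensorRightHomEquiv]

/-- The linear version of `tensorLeftHomEquiv`. -/
def tensorLeftHomLinearEquiv (X Y Y' Z : C) [ExactPairing Y Y'] :
    (Y' ⊗ X ⟶ Z) ≃ₗ[k] (X ⟶ Y ⊗ Z) where
  toEquiv := tensorLeftHomEquiv X Y Y' Z
  map_add' f g := by simp [tensorLeftHomEquiv]
  map_smul' r f := by simp [tensorLeftHomEquiv]

variable (P Q : C) [ExactPairing P Q] [ExactPairing Q P]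

/-- If `Q` is both a left and a right dual of `P`, then `Hom(1, X ⊗ Q) ≅ Hom(1, Q ⊗ X)`. -/
def coevalSwap (X : C) : (𝟙_ C ⟶ X ⊗ Q) ≃ₗ[k] (𝟙_ C ⟶ Q ⊗ X) :=
  -- The pairing `(P, Q)` identifies the first space with `Hom(P, X)`, and the pairing `(Q, P)`
  -- identifies `Hom(P, X)` with the second.
  (tensorRightHomLinearEquiv k (𝟙_ C) P Q X).symm ≪≫ₗ
    homFromLinearEquiv k X (λ_ P ≪≫ (ρ_ P).symm) ≪≫ₗ
    tensorLeftHomLinearEquiv k (𝟙_ C) Q P X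

theorem coevalSwap_comp {X Y : C} (g : 𝟙_ C ⟶ X ⊗ Q) (f : X ⟶ Y) :
    coevalSwap k P Q Y (g ≫ f ▷ Q) = coevalSwap k P Q X g ≫ Q ◁ f := by
  obtain ⟨g, rfl⟩ := (tensorRightHomEquiv (𝟙_ C) P Q X).surjective g
  change tensorLeftHomEquiv (𝟙_ C) Q P Y
      ((λ_ P ≪≫ (ρ_ P).symm).inv ≫ (tensorRightHomEquiv (𝟙_ C) P Q Y).symm _) =
    tensorLeftHomEquiv (𝟙_ C) Q P X
      ((λ_ P ≪≫ (ρ_ P).symm).inv ≫ (tensorRightHomEquiv (𝟙_ C) P Q X).symm _) ≫ _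
  rw [← tensorRightHomEquiv_naturality, ← tensorLeftHomEquiv_naturality]
  simp

/-- If `Q` is both a left and a right dual of `P`, then `Hom(P ⊗ X, 1) ≅ Hom(X ⊗ P, 1)`. -/
def evalSwap (X : C) : (P ⊗ X ⟶ 𝟙_ C) ≃ₗ[k] (X ⊗ P ⟶ 𝟙_ C) :=
  -- Both spaces are `Hom(X, Q)`, through the pairings `(Q, P)` and `(P, Q)`.
  tensorLeftHomLinearEquiv k X Q P (𝟙_ C) ≪≫ₗ
    homToLinearEquiv k X (ρ_ Q ≪≫ (λ_ Q).symm) ≪≫ₗ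
    (tensorRightHomLinearEquiv k X P Q (𝟙_ C)).symm

theorem evalSwap_comp {X Y : C} (f : X ⟶ Y) (g : P ⊗ Y ⟶ 𝟙_ C) :
    evalSwap k P Q X (P ◁ f ≫ g) = f ▷ P ≫ evalSwap k P Q Y g := by
  change (tensorRightHomEquiv X P Q (𝟙_ C)).symm
      (tensorLeftHomEquiv X Q P (𝟙_ C) _ ≫ (ρ_ Q ≪≫ (λ_ Q).symm).hom) =
    _ ≫ (tensorRightHomEquiv Y P Q (𝟙_ C)).symm
      (tensorLeftHomEquiv Y Q P (𝟙_ C) _ ≫ (ρ_ Q ≪≫ (λ_ Q).symm).hom)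
  rw [Equiv.symm_apply_eq, tensorRightHomEquiv_naturality_left, Equiv.apply_symm_apply,
    tensorLeftHomEquiv_naturality_left]
  simp

end LinearEquivs

/-! ### Tensoring the modular object with a dualizable object -/

section Modular

variable (k : Type w) [Field k] {C : Type u} [Category.{v} C] [Abelian C] [Linear k C]
  [MonoidalCategory C] [MonoidalPreadditive C] [MonoidalLinear k C] [RigidCategory C]
  [IsFiniteAbelian k C]

/-- Morphisms `P ⊗ α ⟶ V` in terms of families of linear maps. -/
def tensorModularHomEquiv (P Q : C) [ExactPairing Q P] (V : C) :
    (P ⊗ modularObject k C ⟶ V) ≃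
      DualFamily k (tensorRight P ⋙ 𝟭 C) (𝟙_ C) (𝟙_ C) (tensorRight V) :=
  -- `Hom(P ⊗ α, V) ≅ Hom(α, Q ⊗ V)` gives families with values in `Hom(1, X ⊗ Q ⊗ V)`; then `- ⊗ Q
  -- ⊣ - ⊗ P` trades `Q` in the target for `P` in the source.
  ((tensorLeftHomEquiv (modularObject k C) Q P V).trans (modularObjectHomEquiv k (Q ⊗ V))).trans
    ((DualFamily.congrRight (𝟭 C) (𝟙_ C) (H' := tensorRight Q ⋙ tensorRight V)
      (fun X => homToLinearEquiv k (𝟙_ C) (α_ X Q V).symm) (fun f g => by simp)).trans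
    (DualFamily.precompEquiv (tensorRightAdjunction Q P) (𝟭 C) (𝟙_ C) (𝟙_ C)
      (tensorRight V)).symm)

theorem tensorModularHomEquiv_comp (P Q : C) [ExactPairing Q P] {V W : C}
    (f : P ⊗ modularObject k C ⟶ V) (g : V ⟶ W) :
    tensorModularHomEquiv k P Q W (f ≫ g) =
      (tensorModularHomEquiv k P Q V f).postcomp ((tensoringRight C).map g) := by
  simp only [tensorModularHomEquiv, Equiv.trans_apply]
  rw [Equiv.symm_apply_eq, DualFamily.precompEquiv_postcomp, Equiv.apply_symm_apply,
    tensorLeftHomEquiv_naturality, modularObjectHomEquiv_comp]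
  have key (X : C) (h : 𝟙_ C ⟶ X ⊗ Q ⊗ V) :
      (h ≫ X ◁ Q ◁ g) ≫ (α_ X Q W).inv = (h ≫ (α_ X Q V).inv) ≫ (X ⊗ Q) ◁ g := by simp
  ext X ξ
  exact key X _

/-- If `Q` is both a left and a right dual of `P`, then morphisms `α ⊗ P ⟶ V` correspond to the
same families of linear maps as morphisms `P ⊗ α ⟶ V`. -/
def modularTensorHomEquiv (P Q : C) [ExactPairing P Q] [ExactPairing Q P] (V : C) :
    (modularObject k C ⊗ P ⟶ V) ≃
      DualFamily k (tensorRight P ⋙ 𝟭 C) (𝟙_ C) (𝟙_ C) (tensorRight V) :=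
  -- Here the values lie in `Hom(1, X ⊗ V ⊗ Q)`, with `Q` on the far side of `V`. `coevalSwap` moves
  -- it to the left of `X`, the adjunction `Q ⊗ - ⊣ P ⊗ -` puts `P` in the source, and `evalSwap`
  -- turns `P ⊗ X` into `X ⊗ P`.
  ((tensorRightHomEquiv (modularObject k C) P Q V).trans (modularObjectHomEquiv k (V ⊗ Q))).trans
    (((DualFamily.congrRight (𝟭 C) (𝟙_ C) (H' := tensorLeft Q ⋙ tensorRight V)
      (fun X => homToLinearEquiv k (𝟙_ C) (α_ X V Q).symm ≪≫ₗ
        coevalSwap k P Q (X ⊗ V) ≪≫ₗ homToLinearEquiv k (𝟙_ C) (α_ Q X V).symm)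
      (fun {X Y} f g => by
        have := coevalSwap_comp k P Q (g ≫ (α_ X V Q).inv) (f ▷ V)
        simp at this
        simp [this])).trans
    (DualFamily.precompEquiv (tensorLeftAdjunction P Q) (𝟭 C) (𝟙_ C) (𝟙_ C)
      (tensorRight V)).symm).trans
    (DualFamily.congrLeft (G := tensorLeft P ⋙ 𝟭 C) (G' := tensorRight P ⋙ 𝟭 C) (𝟙_ C)
      (tensorRight V) (fun X => evalSwap k P Q X) (fun f g => evalSwap_comp k P Q f g)))

theorem modularTensorHomEquiv_comp (P Q : C) [ExactPairing P Q] [ExactPairing Q P] {V W : C}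
    (f : modularObject k C ⊗ P ⟶ V) (g : V ⟶ W) :
    modularTensorHomEquiv k P Q W (f ≫ g) =
      (modularTensorHomEquiv k P Q V f).postcomp ((tensoringRight C).map g) := by
  simp only [modularTensorHomEquiv, Equiv.trans_apply]
  refine Eq.trans (congrArg (DualFamily.congrLeft _ _ _ _) ?_)
    (DualFamily.congrLeft_postcomp (G := tensorLeft P ⋙ 𝟭 C) (G' := tensorRight P ⋙ 𝟭 C)
      (fun X => evalSwap k P Q X) (fun f g => evalSwap_comp k P Q f g)
      ((tensoringRight C).map g) _)
  rw [Equiv.symm_apply_eq, DualFamily.precompEquiv_postcomp, Equiv.apply_symm_apply,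
    tensorRightHomEquiv_naturality, modularObjectHomEquiv_comp]
  have key (X : C) (h : 𝟙_ C ⟶ X ⊗ V ⊗ Q) :
      coevalSwap k P Q (X ⊗ W) ((h ≫ X ◁ g ▷ Q) ≫ (α_ X W Q).inv) ≫ (α_ Q X W).inv =
        (coevalSwap k P Q (X ⊗ V) (h ≫ (α_ X V Q).inv) ≫ (α_ Q X V).inv) ≫ (Q ⊗ X) ◁ g := by
    rw [Category.assoc h, associator_inv_naturality_middle, ← Category.assoc h, coevalSwap_comp]
    simp
  ext X ξ
  exact key X _

/-- The modular object commutes with objects whose left and right duals agree. -/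
theorem nonempty_tensor_modularObject_iso (P Q : C) [ExactPairing P Q] [ExactPairing Q P] :
    Nonempty (P ⊗ modularObject k C ≅ modularObject k C ⊗ P) :=
  nonempty_iso_of_equivs (fun g φ => φ.postcomp ((tensoringRight C).map g))
    (tensorModularHomEquiv k P Q) (modularTensorHomEquiv k P Q)
    (tensorModularHomEquiv_comp k P Q) (modularTensorHomEquiv_comp k P Q)

end Modular

/-! ### The projection formula -/

section Projection

open Functor.LaxMonoidal Functor.OplaxMonoidal Functor.Monoidal

variable {C : Type u₁} [Category.{v₁} C] [MonoidalCategory C]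
  {D : Type u₂} [Category.{v₂} D] [MonoidalCategory D] {F : C ⥤ D} [F.Monoidal] {R : D ⥤ C}

/-- For `F ⊣ R` with `F` monoidal and `X` dualizable,
`Hom(A, X ⊗ R V) → Hom(F A, F X ⊗ V)` is bijective. -/
theorem projection_bijective (adj : F ⊣ R) (A X X' : C) [ExactPairing X X'] (V : D) :
    Function.Bijective (fun f : A ⟶ X ⊗ R.obj V =>
      F.map f ≫ δ F X (R.obj V) ≫ F.obj X ◁ adj.counit.app V) := by
  let _ := exactPairingMap F X X'
  -- `Hom(A, X ⊗ R V) ≅ Hom(X' ⊗ A, R V) ≅ Hom(F X' ⊗ F A, V) ≅ Hom(F A, F X ⊗ V)`, as `F X'` is a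
  -- dual of `F X`.
  let e : (A ⟶ X ⊗ R.obj V) ≃ (F.obj A ⟶ F.obj X ⊗ V) :=
    (tensorLeftHomEquiv A X X' (R.obj V)).symm.trans
      ((adj.homEquiv _ _).symm.trans ((Functor.Monoidal.μIso F X' A).symm.homFromEquiv.trans
        (tensorLeftHomEquiv (F.obj A) (F.obj X) (F.obj X') V)))
  convert! e.bijective using 1
  ext f
  obtain ⟨g, rfl⟩ := (tensorLeftHomEquiv A X X' (R.obj V)).surjective f
  simp only [e, Equiv.trans_apply, Equiv.symm_apply_apply]
  change _ = (λ_ _).inv ≫ (ε F ≫ F.map (η_ X X') ≫ δ F X X') ▷ _ ≫ (α_ _ _ _).hom ≫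
    _ ◁ (μ F X' A ≫ (adj.homEquiv _ _).symm g)
  simp [tensorLeftHomEquiv, Adjunction.homEquiv_counit]

end Projection

/-! ### Comparison of `χ ⊗ α_D` with `F α_C` -/

section Relative

open Functor.LaxMonoidal Functor.OplaxMonoidal Functor.Monoidal

variable (k : Type w) [Field k]
    {C : Type u₁} [Category.{v₁} C] [Abelian C] [Linear k C] [MonoidalCategory C]
    {D : Type u₂} [Category.{v₂} D] [Abelian D] [Linear k D] [MonoidalCategory D]
    {F : C ⥤ D} [F.Monoidal] [F.Additive] [F.Linear k] {L R : D ⥤ C}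

/-- `Hom(R Y, 1) ≅ Hom(Y ⊗ χ, 1)` if `R ≅ L(- ⊗ χ)` and `L ⊣ F`. -/
def relativeUnit (adj : L ⊣ F) {χ : D} (i : R ≅ tensorRight χ ⋙ L) (Y : D) :
    (R.obj Y ⟶ 𝟙_ C) ≃ₗ[k] (Y ⊗ χ ⟶ 𝟙_ D) where
  toEquiv := (i.app Y).homFromEquiv.trans ((adj.homEquiv (Y ⊗ χ) (𝟙_ C)).trans
    (εIso F).symm.homToEquiv)
  map_add' f g := by simp [Adjunction.homEquiv_unit]
  map_smul' r f := by simp [Adjunction.homEquiv_unit]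

theorem relativeUnit_apply (adj : L ⊣ F) {χ : D} (i : R ≅ tensorRight χ ⋙ L) (Y : D)
    (f : R.obj Y ⟶ 𝟙_ C) : relativeUnit k adj i Y f =
      adj.unit.app (Y ⊗ χ) ≫ F.map (i.inv.app Y) ≫ F.map f ≫ η F := by
  change (adj.homEquiv (Y ⊗ χ) (𝟙_ C)) (i.inv.app Y ≫ f) ≫ η F = _
  simp [Adjunction.homEquiv_unit]

theorem relativeUnit_comp (adj : L ⊣ F) {χ : D} (i : R ≅ tensorRight χ ⋙ L) {Y Z : D}
    (f : Y ⟶ Z) (g : R.obj Z ⟶ 𝟙_ C) :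
    relativeUnit k adj i Y (R.map f ≫ g) = f ▷ χ ≫ relativeUnit k adj i Z g := by
  have h := i.inv.naturality f
  have h' := adj.unit.naturality (f ▷ χ)
  simp only [Functor.comp_map, Functor.flip_obj_map, curriedTensor_map_app, Functor.id_map] at h h'
  rw [relativeUnit_apply, relativeUnit_apply, reassoc_of% h', F.map_comp, Category.assoc,
    ← F.map_comp_assoc (L.map (f ▷ χ)), h, F.map_comp, Category.assoc]

variable [RigidCategory C]

/-- `Hom(1, X ⊗ R V) ≅ Hom(1, F X ⊗ V)` for `F ⊣ R`. -/
def projectionUnit (adj : F ⊣ R) (X : C) (V : D) :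
    (𝟙_ C ⟶ X ⊗ R.obj V) ≃ₗ[k] (𝟙_ D ⟶ F.obj X ⊗ V) :=
  LinearEquiv.ofBijective
    ((Linear.rightComp k (F.obj (𝟙_ C)) (δ F X (R.obj V) ≫ F.obj X ◁ adj.counit.app V)).comp
      (F.mapLinearMap k)) (projection_bijective adj (𝟙_ C) X (Xᘁ) V) ≪≫ₗ
    homFromLinearEquiv k _ (εIso F).symm

theorem projectionUnit_apply (adj : F ⊣ R) (X : C) (V : D) (f : 𝟙_ C ⟶ X ⊗ R.obj V) :
    projectionUnit k adj X V f =
      ε F ≫ F.map f ≫ δ F X (R.obj V) ≫ F.obj X ◁ adj.counit.app V := by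
  rfl

variable [MonoidalPreadditive C] [MonoidalLinear k C] [IsFiniteAbelian k C]

/-- Morphisms `F α_C ⟶ V` in terms of families of linear maps. -/
def mapModularHomEquiv (adjL : L ⊣ F) (adjR : F ⊣ R) {χ : D} (i : R ≅ tensorRight χ ⋙ L)
    (V : D) : (F.obj (modularObject k C) ⟶ V) ≃
      DualFamily k (tensorRight χ ⋙ 𝟭 D) (𝟙_ D) (𝟙_ D) (tensorRight V) :=
  -- The adjunction `F ⊣ R` is used twice, on `Hom(F α, V)` and to trade `F` in the target of the
  -- families for `R` in the source; `relativeUnit` then replaces `Hom(R Y, 1)`.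
  ((adjR.homEquiv (modularObject k C) V).trans (modularObjectHomEquiv k (R.obj V))).trans
    (((DualFamily.congrRight (𝟭 C) (𝟙_ C) (H' := F ⋙ tensorRight V)
      (fun X => projectionUnit k adjR X V) (fun {X Y} f g => by
        simp [projectionUnit_apply, whisker_exchange])).trans
    (DualFamily.precompEquiv adjR (𝟭 C) (𝟙_ C) (𝟙_ D) (tensorRight V)).symm).trans
    (DualFamily.congrLeft (G := R ⋙ 𝟭 C) (G' := tensorRight χ ⋙ 𝟭 D) (𝟙_ D)
      (tensorRight V) (fun Y => relativeUnit k adjL i Y)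
      (fun f g => relativeUnit_comp k adjL i f g)))

theorem mapModularHomEquiv_comp (adjL : L ⊣ F) (adjR : F ⊣ R) {χ : D}
    (i : R ≅ tensorRight χ ⋙ L) {V W : D} (f : F.obj (modularObject k C) ⟶ V) (g : V ⟶ W) :
    mapModularHomEquiv k adjL adjR i W (f ≫ g) =
      (mapModularHomEquiv k adjL adjR i V f).postcomp ((tensoringRight D).map g) := by
  simp only [mapModularHomEquiv, Equiv.trans_apply]
  refine Eq.trans (congrArg (DualFamily.congrLeft _ _ _ _) ?_)
    (DualFamily.congrLeft_postcomp (G := R ⋙ 𝟭 C) (G' := tensorRight χ ⋙ 𝟭 D)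
      (fun Y => relativeUnit k adjL i Y) (fun f g => relativeUnit_comp k adjL i f g)
      ((tensoringRight D).map g) _)
  rw [Equiv.symm_apply_eq, DualFamily.precompEquiv_postcomp, Equiv.apply_symm_apply,
    adjR.homEquiv_naturality_right, modularObjectHomEquiv_comp]
  have key (X : C) (h : 𝟙_ C ⟶ X ⊗ R.obj V) : projectionUnit k adjR X W (h ≫ X ◁ R.map g) =
      projectionUnit k adjR X V h ≫ F.obj X ◁ g := by
    simp only [projectionUnit_apply, F.map_comp, Category.assoc]
    rw [← δ_natural_right_assoc, ← MonoidalCategory.whiskerLeft_comp,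
      ← MonoidalCategory.whiskerLeft_comp]
    exact congrArg (fun t => ε F ≫ F.map h ≫ δ F X (R.obj V) ≫ F.obj X ◁ t)
      (adjR.counit_naturality g)
  ext X ξ
  exact key X _

/-- Both objects corepresent the families `Hom(Y ⊗ χ, 1)^* → Hom(1, Y ⊗ V)`. -/
theorem nonempty_tensor_modularObject_iso_map [MonoidalPreadditive D] [MonoidalLinear k D]
    [RigidCategory D] [IsFiniteAbelian k D] (adjL : L ⊣ F) (adjR : F ⊣ R) {χ : D} (i : R ≅ tensorRight χ ⋙ L) :
    Nonempty (χ ⊗ modularObject k D ≅ F.obj (modularObject k C)) :=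
  nonempty_iso_of_equivs (fun g φ => φ.postcomp ((tensoringRight D).map g))
    (tensorModularHomEquiv k χ (ᘁχ)) (mapModularHomEquiv k adjL adjR i)
    (tensorModularHomEquiv_comp k χ (ᘁχ)) (mapModularHomEquiv_comp k adjL adjR i)

end Relative

/-! ### Double duals and adjoints of monoidal functors -/

section DoubleDual

variable {C : Type u₁} [Category.{v₁} C] [MonoidalCategory C]

theorem mateEquiv_comp {X X' Y Y' Z Z' : C} [ExactPairing X X'] [ExactPairing Y Y']
    [ExactPairing Z Z'] (f : X ⟶ Y) (g : Y ⟶ Z) :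
    mateEquiv X X' Z Z' (f ≫ g) = mateEquiv Y Y' Z Z' g ≫ mateEquiv X X' Y Y' f :=
  ((isMate_mateEquiv f).comp (isMate_mateEquiv g)).mateEquiv_eq

/-- Double transposition of morphisms along exact pairings. -/
def doubleMateEquiv (X X' X'' Y Y' Y'' : C) [ExactPairing X X'] [ExactPairing X' X'']
    [ExactPairing Y Y'] [ExactPairing Y' Y''] : (X ⟶ Y) ≃ (X'' ⟶ Y'') :=
  (mateEquiv X X' Y Y').trans (mateEquiv Y' Y'' X' X'')

theorem doubleMateEquiv_comp {X X' X'' Y Y' Y'' Z Z' Z'' : C} [ExactPairing X X']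
    [ExactPairing X' X''] [ExactPairing Y Y'] [ExactPairing Y' Y''] [ExactPairing Z Z']
    [ExactPairing Z' Z''] (f : X ⟶ Y) (g : Y ⟶ Z) :
    doubleMateEquiv X X' X'' Z Z' Z'' (f ≫ g) =
      doubleMateEquiv X X' X'' Y Y' Y'' f ≫ doubleMateEquiv Y Y' Y'' Z Z' Z'' g := by
  simp only [doubleMateEquiv, Equiv.trans_apply]
  rw [mateEquiv_comp (Y := Y) (Y' := Y'), mateEquiv_comp (Y := Y') (Y' := Y'')]

theorem doubleMateEquiv_symm_comp {X X' X'' Y Y' Y'' Z Z' Z'' : C} [ExactPairing X X']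
    [ExactPairing X' X''] [ExactPairing Y Y'] [ExactPairing Y' Y''] [ExactPairing Z Z']
    [ExactPairing Z' Z''] (f : X'' ⟶ Y'') (g : Y'' ⟶ Z'') :
    (doubleMateEquiv X X' X'' Z Z' Z'').symm (f ≫ g) =
      (doubleMateEquiv X X' X'' Y Y' Y'').symm f ≫
        (doubleMateEquiv Y Y' Y'' Z Z' Z'').symm g := by
  rw [Equiv.symm_apply_eq, doubleMateEquiv_comp (Y := Y) (Y' := Y') (Y'' := Y''),
    Equiv.apply_symm_apply, Equiv.apply_symm_apply]

theorem doubleMateEquiv_id (X X' X'' : C) [ExactPairing X X'] [ExactPairing X' X''] :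
    doubleMateEquiv X X' X'' X X' X'' (𝟙 X) = 𝟙 X'' := by
  simp only [doubleMateEquiv, Equiv.trans_apply]
  rw [(isMate_id X X').mateEquiv_eq, (isMate_id X' X'').mateEquiv_eq]

section Map

attribute [local instance] exactPairingMap

variable {D : Type u₂} [Category.{v₂} D] [MonoidalCategory D] (F : C ⥤ D) [F.Monoidal]

/-- `F` preserves mates and mates are unique; the dual and double dual of `F X` are taken to be the
images under `F`. -/
theorem doubleMateEquiv_map {X X' X'' Y Y' Y'' : C} [ExactPairing X X'] [ExactPairing X' X'']
    [ExactPairing Y Y'] [ExactPairing Y' Y''] (f : X ⟶ Y) :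
    doubleMateEquiv (F.obj X) (F.obj X') (F.obj X'') (F.obj Y) (F.obj Y') (F.obj Y'')
      (F.map f) = F.map (doubleMateEquiv X X' X'' Y Y' Y'' f) := by
  simp only [doubleMateEquiv, Equiv.trans_apply]
  rw [((isMate_mateEquiv (X' := X') (Y' := Y') f).map F).mateEquiv_eq,
    ((isMate_mateEquiv (X' := Y'') (Y' := X'') _).map F).mateEquiv_eq]

end Map

section Rigid

variable (C) [RigidCategory C]

/-- The functor `X ↦ X**`. -/
def doubleRightDual : C ⥤ C where
  obj X := (Xᘁ)ᘁ
  map {X Y} f := doubleMateEquiv X (Xᘁ) ((Xᘁ)ᘁ) Y (Yᘁ) ((Yᘁ)ᘁ) f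
  map_id _ := doubleMateEquiv_id _ _ _
  map_comp f g := doubleMateEquiv_comp f g

/-- The functor `X ↦ **X`. -/
def doubleLeftDual : C ⥤ C where
  obj X := ᘁ(ᘁX : C)
  map {X Y} f := (doubleMateEquiv (ᘁ(ᘁX : C)) (ᘁX) X (ᘁ(ᘁY : C)) (ᘁY) Y).symm f
  map_id X := by rw [Equiv.symm_apply_eq, doubleMateEquiv_id]
  map_comp f g := doubleMateEquiv_symm_comp f g

/-- The adjunction between the functors `X ↦ **X` and `X ↦ X**`. -/
def doubleDualAdjunction : doubleLeftDual C ⊣ doubleRightDual C :=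
  Adjunction.mkOfHomEquiv
    { homEquiv X Y := doubleMateEquiv (ᘁ(ᘁX : C)) (ᘁX) X Y (Yᘁ) ((Yᘁ)ᘁ)
      homEquiv_naturality_left_symm {X X' Y} f g :=
        doubleMateEquiv_symm_comp (X := ᘁ(ᘁX : C)) (X' := ᘁX) (Y := ᘁ(ᘁX' : C)) (Y' := ᘁX')
          (Z := Y) (Z' := Yᘁ) (Z'' := (Yᘁ)ᘁ) f g
      homEquiv_naturality_right {X Y Y'} f g :=
        doubleMateEquiv_comp (X := ᘁ(ᘁX : C)) (X' := ᘁX) (X'' := X) (Y := Y) (Y' := Yᘁ)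
          (Y'' := (Yᘁ)ᘁ) (Z := Y') (Z' := Y'ᘁ) (Z'' := (Y'ᘁ)ᘁ) f g }

variable {C} {D : Type u₂} [Category.{v₂} D] [MonoidalCategory D] [RigidCategory D]
  {F : C ⥤ D} [F.Monoidal] {R : D ⥤ C}

section MapAdjunction

attribute [local instance] exactPairingMap

/-- `Hom(F(**X), Y) ≅ Hom(F X, Y**) ≅ Hom(X, R(Y**))`. -/
def doubleDualMapHomEquiv (adj : F ⊣ R) (X : C) (Y : D) :
    (F.obj (ᘁ(ᘁX : C)) ⟶ Y) ≃ (X ⟶ R.obj ((Yᘁ)ᘁ)) :=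
  (doubleMateEquiv (F.obj (ᘁ(ᘁX : C))) (F.obj (ᘁX)) (F.obj X) Y (Yᘁ) ((Yᘁ)ᘁ)).trans
    (adj.homEquiv X ((Yᘁ)ᘁ))

theorem doubleDualMapHomEquiv_naturality_left_symm (adj : F ⊣ R) {X X' : C} {Y : D}
    (f : X ⟶ X') (g : X' ⟶ R.obj ((Yᘁ)ᘁ)) :
    (doubleDualMapHomEquiv adj X Y).symm (f ≫ g) =
      F.map ((doubleMateEquiv (ᘁ(ᘁX : C)) (ᘁX) X (ᘁ(ᘁX' : C)) (ᘁX') X').symm f) ≫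
        (doubleDualMapHomEquiv adj X' Y).symm g := by
  simp only [doubleDualMapHomEquiv, Equiv.symm_trans_apply, adj.homEquiv_naturality_left_symm]
  rw [doubleMateEquiv_symm_comp (Y := F.obj (ᘁ(ᘁX' : C))) (Y' := F.obj (ᘁX'))]
  congr 1
  rw [Equiv.symm_apply_eq, doubleMateEquiv_map, Equiv.apply_symm_apply]

theorem doubleDualMapHomEquiv_naturality_right (adj : F ⊣ R) {X : C} {Y Y' : D}
    (f : F.obj (ᘁ(ᘁX : C)) ⟶ Y) (g : Y ⟶ Y') :
    doubleDualMapHomEquiv adj X Y' (f ≫ g) = doubleDualMapHomEquiv adj X Y f ≫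
      R.map (doubleMateEquiv Y (Yᘁ) ((Yᘁ)ᘁ) Y' (Y'ᘁ) ((Y'ᘁ)ᘁ) g) := by
  simp only [doubleDualMapHomEquiv, Equiv.trans_apply]
  rw [doubleMateEquiv_comp (Y := Y) (Y' := Yᘁ) (Y'' := (Yᘁ)ᘁ), adj.homEquiv_naturality_right]

end MapAdjunction

/-- For `F ⊣ R`, the functor `X ↦ F(**X)` is left adjoint to `Y ↦ R(Y**)`. -/
def doubleDualMapAdjunction (adj : F ⊣ R) : doubleLeftDual C ⋙ F ⊣ doubleRightDual D ⋙ R :=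
  Adjunction.mkOfHomEquiv
    { homEquiv X Y := doubleDualMapHomEquiv adj X Y
      homEquiv_naturality_left_symm f g := doubleDualMapHomEquiv_naturality_left_symm adj f g
      homEquiv_naturality_right f g := doubleDualMapHomEquiv_naturality_right adj f g }

/-- A right adjoint of a monoidal functor between rigid categories commutes with double duals. -/
def doubleRightDualCompIso (adj : F ⊣ R) : doubleRightDual D ⋙ R ≅ R ⋙ doubleRightDual C :=
  -- Both functors are right adjoint to `X ↦ F(**X)`.
  (doubleDualMapAdjunction adj).rightAdjointUniq ((doubleDualAdjunction C).comp adj)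

/-- An object representing `Hom(R(-), 1)` is isomorphic to its double dual. -/
theorem nonempty_iso_doubleLeftDual (adj : F ⊣ R) (c : D)
    (e : ∀ Y, (R.obj Y ⟶ 𝟙_ C) ≃ (Y ⟶ c))
    (he : ∀ {Y Z : D} (f : Y ⟶ Z) (g : R.obj Z ⟶ 𝟙_ C), e Y (R.map f ≫ g) = f ≫ e Z g) :
    Nonempty (c ≅ ᘁ(ᘁc : D)) := by
  obtain ⟨i, hi⟩ : ∃ i : ∀ V : D, R.obj ((Vᘁ)ᘁ) ≅ ((R.obj V)ᘁ)ᘁ, ∀ {V W : D} (f : V ⟶ W),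
      R.map (doubleMateEquiv V (Vᘁ) ((Vᘁ)ᘁ) W (Wᘁ) ((Wᘁ)ᘁ) f) ≫ (i W).hom =
        (i V).hom ≫ doubleMateEquiv (R.obj V) ((R.obj V)ᘁ) (((R.obj V)ᘁ)ᘁ)
          (R.obj W) ((R.obj W)ᘁ) (((R.obj W)ᘁ)ᘁ) (R.map f) :=
    ⟨fun V => (doubleRightDualCompIso adj).app V,
      fun f => (doubleRightDualCompIso adj).hom.naturality f⟩
  -- `Hom(V, c) ≅ Hom(R V, 1) ≅ Hom((R V)**, 1) ≅ Hom(R(V**), 1) ≅ Hom(V**, c) ≅ Hom(V, **c)`, with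
  -- the unit object as its own dual.
  let E (V : D) : (V ⟶ c) ≃ (V ⟶ ᘁ(ᘁc : D)) :=
    (e V).symm.trans ((doubleMateEquiv (R.obj V) ((R.obj V)ᘁ) (((R.obj V)ᘁ)ᘁ)
      (𝟙_ C) (𝟙_ C) (𝟙_ C)).trans ((i V).symm.homFromEquiv.trans
      ((e ((Vᘁ)ᘁ)).trans (doubleMateEquiv V (Vᘁ) ((Vᘁ)ᘁ) (ᘁ(ᘁc : D)) (ᘁc) c).symm)))
  refine ⟨Yoneda.ext _ _ (fun {V} => E V) (fun {V} => (E V).symm) (fun f => by simp)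
    (fun f => by simp) fun {V V'} f g => ?_⟩
  obtain ⟨g, rfl⟩ := (e V).surjective g
  simp only [E, Equiv.trans_apply, ← he, Equiv.symm_apply_apply, Iso.homFromEquiv_apply,
    Iso.symm_inv]
  rw [doubleMateEquiv_comp (Y := R.obj V) (Y' := (R.obj V)ᘁ) (Y'' := ((R.obj V)ᘁ)ᘁ),
    Equiv.symm_apply_eq, doubleMateEquiv_comp (Y := V) (Y' := Vᘁ) (Y'' := (Vᘁ)ᘁ),
    Equiv.apply_symm_apply, ← he, ← Category.assoc, ← hi, Category.assoc]

end Rigid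

end DoubleDual

/-! ### Construction of a relative modular object -/

section Existence

open Functor.LaxMonoidal Functor.OplaxMonoidal Functor.Monoidal

variable {C : Type u₁} [Category.{v₁} C] [MonoidalCategory C]
  {D : Type u₂} [Category.{v₂} D] [MonoidalCategory D]
  {F : C ⥤ D} [F.Monoidal] {L R : D ⥤ C}

/-- The canonical morphism `X ⊗ R V ⟶ R (F X ⊗ V)`. -/
def projectionHom (adj : F ⊣ R) (X : C) (V : D) : X ⊗ R.obj V ⟶ R.obj (F.obj X ⊗ V) :=
  adj.homEquiv _ _ (δ F X (R.obj V) ≫ F.obj X ◁ adj.counit.app V)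

theorem projectionHom_naturality_left (adj : F ⊣ R) {X Y : C} (f : X ⟶ Y) (V : D) :
    f ▷ R.obj V ≫ projectionHom adj Y V = projectionHom adj X V ≫ R.map (F.map f ▷ V) := by
  unfold projectionHom
  rw [← adj.homEquiv_naturality_left, ← adj.homEquiv_naturality_right]
  congr 1
  rw [Category.assoc, whisker_exchange, ← δ_natural_left_assoc]

theorem projectionHom_naturality_right (adj : F ⊣ R) (X : C) {V W : D} (f : V ⟶ W) :
    X ◁ R.map f ≫ projectionHom adj X W = projectionHom adj X V ≫ R.map (F.obj X ◁ f) := by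
  unfold projectionHom
  rw [← adj.homEquiv_naturality_left, ← adj.homEquiv_naturality_right]
  congr 1
  rw [Category.assoc, ← δ_natural_right_assoc, ← MonoidalCategory.whiskerLeft_comp,
    ← MonoidalCategory.whiskerLeft_comp]
  exact congrArg (fun t => δ F X (R.obj V) ≫ F.obj X ◁ t) (adj.counit_naturality f)

variable [RigidCategory C]

/-- By Yoneda: under `F ⊣ R`, composition with this morphism becomes the bijection of
`projection_bijective`. -/
instance (adj : F ⊣ R) (X : C) (V : D) : IsIso (projectionHom adj X V) := by
  refine isIso_of_yoneda_map_bijective _ fun A => ?_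
  convert! (adj.homEquiv A _).bijective.comp (projection_bijective adj A X (Xᘁ) V) using 1
  ext f
  exact (adj.homEquiv_naturality_left f _).symm

/-- `Hom(R V, X) ≅ Hom(V, F X ⊗ c)` if `c` represents `Hom(R(-), 1)`. -/
def representedHomEquiv (adj : F ⊣ R) {c : D} (e : ∀ Y, (R.obj Y ⟶ 𝟙_ C) ≃ (Y ⟶ c))
    (V : D) (X : C) : (R.obj V ⟶ X) ≃ (V ⟶ F.obj X ⊗ c) :=
  letI := exactPairingMap F X (Xᘁ)
  -- With `X*` for `Xᘁ`: `Hom(R V, X) ≅ Hom(X* ⊗ R V, 1) ≅ Hom(R(F X* ⊗ V), 1) ≅ Hom(F X* ⊗ V, c) ≅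
  -- Hom(V, F X ⊗ c)`.
  (Equiv.ofBijective _ (evalLeft_bijective (Xᘁ) (R.obj V) X)).trans
    ((asIso (projectionHom adj (Xᘁ) V)).homFromEquiv.trans
      ((e _).trans (tensorLeftHomEquiv V (F.obj X) (F.obj (Xᘁ)) c)))

theorem representedHomEquiv_apply (adj : F ⊣ R) {c : D} (e : ∀ Y, (R.obj Y ⟶ 𝟙_ C) ≃ (Y ⟶ c))
    (V : D) (X : C) (f : R.obj V ⟶ X) :
    letI := exactPairingMap F X (Xᘁ)
    representedHomEquiv adj e V X f = tensorLeftHomEquiv V (F.obj X) (F.obj (Xᘁ)) c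
      (e _ (inv (projectionHom adj (Xᘁ) V) ≫ Xᘁ ◁ f ≫ ε_ X (Xᘁ))) :=
  rfl

/-- If `c` represents `Hom(R(-), 1)`, then `F(-) ⊗ c` is right adjoint to `R`. -/
def representedAdjunction (adj : F ⊣ R) {c : D} (e : ∀ Y, (R.obj Y ⟶ 𝟙_ C) ≃ (Y ⟶ c))
    (he : ∀ {Y Z : D} (f : Y ⟶ Z) (g : R.obj Z ⟶ 𝟙_ C), e Y (R.map f ≫ g) = f ≫ e Z g) :
    R ⊣ F ⋙ tensorRight c :=
  Adjunction.mkOfHomEquiv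
    { homEquiv := representedHomEquiv adj e
      homEquiv_naturality_left_symm {V W X} f g := by
        obtain ⟨g, rfl⟩ := (representedHomEquiv adj e W X).surjective g
        rw [Equiv.symm_apply_eq, Equiv.symm_apply_apply, representedHomEquiv_apply,
          representedHomEquiv_apply]
        let _ := exactPairingMap F X (Xᘁ)
        rw [← tensorLeftHomEquiv_naturality_left, ← he, MonoidalCategory.whiskerLeft_comp,
          Category.assoc]
        congr 2
        symm
        rw [IsIso.inv_comp_eq, ← reassoc_of% (projectionHom_naturality_right adj (Xᘁ) f),
          IsIso.hom_inv_id_assoc]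
      homEquiv_naturality_right {V X Y} f g := by
        rw [representedHomEquiv_apply, representedHomEquiv_apply]
        let _ := exactPairingMap F X (Xᘁ)
        let _ := exactPairingMap F Y (Yᘁ)
        have hg := isMate_rightAdjointMate g
        -- The pairing varies with `X`, so `F g` acting on `F X ⊗ c` is traded for `F gᘁ` acting on
        -- the dual.
        refine Eq.trans ?_ ((hg.map F).tensorLeftHomEquiv_comp _).symm
        rw [← he]
        congr 2
        rw [IsIso.inv_comp_eq, ← reassoc_of% (projectionHom_naturality_left adj (gᘁ) V),
          IsIso.hom_inv_id_assoc, MonoidalCategory.whiskerLeft_comp, Category.assoc, hg,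
          whisker_exchange_assoc] }

/-- With `c` the value at `1` of a right adjoint of `R`, both `R` and `L(- ⊗ ᘁc)` are left adjoint
to `F(-) ⊗ c`. -/
theorem exists_isRelativeModularObject_of_isLeftAdjoint [RigidCategory D] (adjL : L ⊣ F)
    (adjR : F ⊣ R) [R.IsLeftAdjoint] : ∃ χ : D, IsRelativeModularObject F χ := by
  let adj := Adjunction.ofIsLeftAdjoint R
  let c : D := R.rightAdjoint.obj (𝟙_ C)
  let adj' : R ⊣ F ⋙ tensorRight c := representedAdjunction adjR
    (fun Y => adj.homEquiv Y (𝟙_ C)) (fun f g => adj.homEquiv_naturality_left f g)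
  exact ⟨ᘁc, L, R, adjL, adjR,
    ⟨adj'.leftAdjointUniq ((tensorRightAdjunction (ᘁc) c).comp adjL)⟩⟩

end Existence

/-! ### Right adjoints of right exact functors, by passing to opposites -/

section Opposite

open Opposite

variable (k : Type w) [Field k]

/-- The opposite of a `k`-linear category is `k`-linear. -/
@[reducible]
def linearOpposite (C : Type u) [Category.{v} C] [Preadditive C] [Linear k C] : Linear k Cᵒᵖ where
  homModule _ _ :=
    { smul r f := (r • f.unop).op
      one_smul f := Quiver.Hom.unop_inj (one_smul k f.unop)
      mul_smul r s f := Quiver.Hom.unop_inj (mul_smul r s f.unop)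
      smul_zero r := Quiver.Hom.unop_inj (smul_zero r)
      smul_add r f g := Quiver.Hom.unop_inj (smul_add r f.unop g.unop)
      add_smul r s f := Quiver.Hom.unop_inj (add_smul r s f.unop)
      zero_smul f := Quiver.Hom.unop_inj (zero_smul k f.unop) }
  smul_comp _ _ _ r f g := Quiver.Hom.unop_inj (Linear.comp_smul _ _ _ g.unop r f.unop)
  comp_smul _ _ _ f r g := Quiver.Hom.unop_inj (Linear.smul_comp _ _ _ r g.unop f.unop)

attribute [local instance] linearOpposite

theorem finite_hom_opposite {C : Type u} [Category.{v} C] [Preadditive C] [Linear k C]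
    [∀ X Y : C, Module.Finite k (X ⟶ Y)] (X Y : Cᵒᵖ) : Module.Finite k (X ⟶ Y) :=
  Module.Finite.equiv (M := (Y.unop ⟶ X.unop))
    { toFun := Quiver.Hom.op
      invFun := Quiver.Hom.unop
      map_add' := fun _ _ => rfl
      map_smul' := fun _ _ => rfl
      left_inv := fun _ => rfl
      right_inv := fun _ => rfl }

/-- A `k`-linear right exact functor between `k`-linear categories with finite-dimensional Hom
spaces, defined on an abelian category with a projective separator, has a right adjoint. -/
theorem isLeftAdjoint_of_finite {C : Type u₁} [Category.{v₁} C] [Abelian C] [Linear k C]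
    {E : Type u₂} [Category.{v₂} E] [Preadditive E] [Linear k E]
    [∀ X Y : C, Module.Finite k (X ⟶ Y)] [∀ X Y : E, Module.Finite k (X ⟶ Y)]
    (P : C) [Projective P] (hP : IsSeparator P) (G : C ⥤ E) [PreservesFiniteColimits G]
    [G.Additive] [G.Linear k] : G.IsLeftAdjoint := by
  have := finite_hom_opposite k (C := C)
  have : PreservesFiniteLimits G.op := preservesFiniteLimits_op G
  have : G.op.Linear k := ⟨fun f r => Quiver.Hom.unop_inj (G.map_smul r f.unop)⟩
  have hI : IsCoseparator (op P) := (isCoseparator_op_iff P).2 hP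
  have := isRightAdjoint_of_finite k (op P) hI G.op
    fun T X => finite_hom_opposite k T (G.op.obj X)
  exact ⟨_, ⟨(Adjunction.ofIsRightAdjoint G.op).unop⟩⟩

end Opposite

section LinearAdjoint

variable (k : Type w) [Field k] {C : Type u₁} [Category.{v₁} C] [Preadditive C] [Linear k C]
  {D : Type u₂} [Category.{v₂} D] [Preadditive D] [Linear k D]

theorem linear_rightAdjoint {F : C ⥤ D} {R : D ⥤ C} (adj : F ⊣ R) [F.Additive] [F.Linear k] :
    R.Linear k where
  map_smul f r := (adj.homEquiv _ _).symm.injective (by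
    simp [Adjunction.homEquiv_counit])

end LinearAdjoint

/-! ### Duals of injective objects -/

section Projective

/-- A lifting problem for `Q` along an epimorphism `q` transposes to an extension problem into `I`
along the mate of `q`, which is a monomorphism. -/
theorem projective_of_exactPairing {C : Type u} [Category.{v} C] [MonoidalCategory C]
    [RigidCategory C] (I Q : C) [ExactPairing I Q] [Injective I] : Projective Q := by
  refine ⟨fun {Y Z} f q _ => ?_⟩
  let m : (ᘁZ : C) ⟶ ᘁY := (mateEquiv (ᘁZ) Z (ᘁY) Y).symm q
  have hm : IsMate m q := isMate_mateEquiv_symm q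
  have : Mono m := by
    refine ⟨fun {W} a b hab => ?_⟩
    have ha : IsMate a (mateEquiv W (Wᘁ) (ᘁZ) Z a) := isMate_mateEquiv a
    have hb : IsMate b (mateEquiv W (Wᘁ) (ᘁZ) Z b) := isMate_mateEquiv b
    have h := ha.comp hm
    rw [hab] at h
    have h' := (cancel_epi q).1 (h.right_unique (hb.comp hm))
    exact (mateEquiv W (Wᘁ) (ᘁZ) Z).injective h'
  let t : (ᘁZ : C) ⟶ I := (mateEquiv (ᘁZ) Z I Q).symm f
  have ht : IsMate t f := isMate_mateEquiv_symm f
  let s : (ᘁY : C) ⟶ I := Injective.factorThru t m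
  have hs : IsMate s (mateEquiv (ᘁY) Y I Q s) := isMate_mateEquiv s
  refine ⟨mateEquiv (ᘁY) Y I Q s, ?_⟩
  have h := hm.comp hs
  rw [Injective.comp_factorThru] at h
  exact h.right_unique ht

end Projective

/-! ### The seven conditions -/

section Conditions

variable {C : Type u₁} [Category.{v₁} C] {D : Type u₂} [Category.{v₂} D] {F : C ⥤ D}
  {L R : D ⥤ C}

/-- A map `P ⟶ R Y` corresponds to a map `F P ⟶ Y`, which lifts along `f` by projectivity. So every
map from the separator `P` to `R Y` factors through `R f`. -/
theorem preservesEpimorphisms_of_projective (adj : F ⊣ R) (P : C) (hP : IsSeparator P)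
    (hFP : Projective (F.obj P)) : R.PreservesEpimorphisms where
  preserves {X Y} f _ := by
    refine ⟨fun {Z} a b hab => (isSeparator_def P).1 hP _ _ fun r => ?_⟩
    obtain ⟨s, hs⟩ := hFP.factors ((adj.homEquiv P Y).symm r) f
    have hr : adj.homEquiv P X s ≫ R.map f = r := by
      rw [← adj.homEquiv_naturality_right, hs, Equiv.apply_symm_apply]
    rw [← hr, Category.assoc, Category.assoc, hab]


variable [Abelian C]

/-- A right adjoint of a functor preserving monomorphisms preserves injectives. Thus `F(ᘁP)` is
injective, and its dual `F P` is projective. -/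
theorem exists_projective_map_of_preservesMonomorphisms (k : Type w) [Field k] [Linear k C]
    [IsFiniteAbelian k C] [MonoidalCategory C] [RigidCategory C] [MonoidalCategory D]
    [RigidCategory D] [F.Monoidal] (adj : L ⊣ F) [L.PreservesMonomorphisms] :
    ∃ P : C, Projective P ∧ IsSeparator P ∧ Projective (F.obj P) := by
  obtain ⟨P, hP, hPs⟩ := exists_projective_separator k C
  have hI : Injective (F.obj (ᘁP)) := adj.map_injective _ (injective_leftDual P)
  let _ := exactPairingMap F (ᘁP) P
  exact ⟨P, hP, hPs, projective_of_exactPairing (F.obj (ᘁP)) (F.obj P)⟩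

variable [Abelian D]

theorem isRightAdjoint_of_preservesFiniteLimits (k : Type w) [Field k] [Linear k C]
    [IsFiniteAbelian k C] [Linear k D] [IsFiniteAbelian k D] [MonoidalCategory C]
    [RigidCategory C] (F : C ⥤ D) [F.Additive] [F.Linear k] [PreservesFiniteLimits F] :
    F.IsRightAdjoint := by
  obtain ⟨P, _, hP⟩ := exists_projective_separator k C
  have := injective_leftDual P
  exact isRightAdjoint_of_finite k (ᘁP) (isCoseparator_leftDual P hP) F
    fun T X => finite_hom k T (F.obj X)

theorem isLeftAdjoint_of_preservesFiniteColimits (k : Type w) [Field k] [Linear k C]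
    [IsFiniteAbelian k C] [Linear k D] [IsFiniteAbelian k D] (F : C ⥤ D) [F.Additive]
    [F.Linear k] [PreservesFiniteColimits F] : F.IsLeftAdjoint := by
  obtain ⟨P, _, hP⟩ := exists_projective_separator k C
  exact isLeftAdjoint_of_finite k P hP F

/-- As a right adjoint, `R` is left exact; preserving epimorphisms makes it exact, and the criterion
for right exact functors applies. -/
theorem isLeftAdjoint_of_preservesEpimorphisms (k : Type w) [Field k] [Linear k C]
    [IsFiniteAbelian k C] [Linear k D] [IsFiniteAbelian k D] [F.Additive] [F.Linear k]
    (adj : F ⊣ R) [R.PreservesEpimorphisms] : R.IsLeftAdjoint := by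
  have := adj.right_adjoint_additive
  have := linear_rightAdjoint k adj
  have : PreservesFiniteLimits R :=
    have := adj.isRightAdjoint
    inferInstance
  have : R.PreservesHomology := R.preservesHomology_of_preservesEpis_and_kernels
  have := R.preservesFiniteColimits_of_preservesHomology
  exact isLeftAdjoint_of_preservesFiniteColimits k R

theorem exists_isRelativeModularObject (k : Type w) [Field k] [Linear k C]
    [IsFiniteAbelian k C] [Linear k D] [IsFiniteAbelian k D] [MonoidalCategory C]
    [RigidCategory C] [MonoidalCategory D] [RigidCategory D] [F.Monoidal] [F.Additive]
    [F.Linear k] [PreservesFiniteLimits F] [PreservesFiniteColimits F]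
    (hF : RelativeModularCondition F) : ∃ χ : D, IsRelativeModularObject F χ := by
  have := isRightAdjoint_of_preservesFiniteLimits k F
  have := isLeftAdjoint_of_preservesFiniteColimits k F
  have adjL := Adjunction.ofIsRightAdjoint F
  have adjR := Adjunction.ofIsLeftAdjoint F
  -- Conditions (1), (4), (6) and (7) all yield such a generator; for (1) and (4), because `L`
  -- preserves monomorphisms.
  have key (h : ∃ P : C, Projective P ∧ IsSeparator P ∧ Projective (F.obj P)) :
      ∃ χ : D, IsRelativeModularObject F χ := by
    obtain ⟨P, -, hP, hFP⟩ := h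
    have := preservesEpimorphisms_of_projective adjR P hP hFP
    have := isLeftAdjoint_of_preservesEpimorphisms k adjR
    exact exists_isRelativeModularObject_of_isLeftAdjoint adjL adjR
  rcases hF with ⟨L, adj, h⟩ | ⟨R, adj, h⟩ | h | ⟨L, adj, h, -⟩ | ⟨R, adj, -, h⟩ | h | h
  · exact key (exists_projective_map_of_preservesMonomorphisms k adj)
  · exact exists_isRelativeModularObject_of_isLeftAdjoint adjL adj
  · exact h
  · exact key (exists_projective_map_of_preservesMonomorphisms k adj)
  · have := isLeftAdjoint_of_preservesEpimorphisms k adj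
    exact exists_isRelativeModularObject_of_isLeftAdjoint adjL adj
  · obtain ⟨P, hP, hPs⟩ := exists_projective_separator k C
    exact key ⟨P, hP, hPs, h P hP⟩
  · exact key h

end Conditions

/-! ### Invertible objects -/

section Invertible

variable {C : Type u} [Category.{v} C] [MonoidalCategory C]

theorem isInvertibleObject_of_left_right {X Y Z : C} (i : X ⊗ Y ≅ 𝟙_ C) (j : Z ⊗ X ≅ 𝟙_ C) :
    IsInvertibleObject X :=
  have e : Z ≅ Y := (ρ_ Z).symm ≪≫ whiskerLeftIso Z i.symm ≪≫ (α_ Z X Y).symm ≪≫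
    whiskerRightIso j Y ≪≫ λ_ Y
  ⟨Y, ⟨i⟩, ⟨whiskerRightIso e.symm X ≪≫ j⟩⟩

/-- If `X ⊗ Y ≅ 1`, then `(- ⊗ X) ⊗ Y` is isomorphic to the identity functor. -/
def tensorRightCompIso {X Y : C} (i : X ⊗ Y ≅ 𝟙_ C) : tensorRight X ⋙ tensorRight Y ≅ 𝟭 C :=
  NatIso.ofComponents (fun A => α_ A X Y ≪≫ whiskerLeftIso A i ≪≫ ρ_ A) fun {A B} f => by
    change f ▷ X ▷ Y ≫ (α_ B X Y).hom ≫ B ◁ i.hom ≫ (ρ_ B).hom =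
      ((α_ A X Y).hom ≫ A ◁ i.hom ≫ (ρ_ A).hom) ≫ f
    rw [associator_naturality_left_assoc, ← whisker_exchange_assoc, rightUnitor_naturality,
      Category.assoc, Category.assoc]

/-- The dual of an invertible object is an inverse. -/
theorem IsInvertibleObject.tensor_dual [RigidCategory C] {X : C} (h : IsInvertibleObject X) :
    Nonempty (X ⊗ Xᘁ ≅ 𝟙_ C) ∧ Nonempty (Xᘁ ⊗ X ≅ 𝟙_ C) := by
  obtain ⟨Y, ⟨i⟩, ⟨j⟩⟩ := h
  -- Since `- ⊗ X` is an equivalence with inverse `- ⊗ Y`, the object `Y` represents `Hom(- ⊗ X,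
  -- 1)`, as `Xᘁ` does.
  let e : C ≌ C := CategoryTheory.Equivalence.mk (tensorRight X) (tensorRight Y)
    (tensorRightCompIso i).symm (tensorRightCompIso j)
  have bij (A : C) : Function.Bijective (fun f : A ⟶ Y => f ▷ X ≫ j.hom) :=
    j.homToEquiv.bijective.comp (e.fullyFaithfulFunctor.map_bijective A Y)
  let E (A : C) : (A ⟶ Y) ≃ (A ⟶ Xᘁ) :=
    (Equiv.ofBijective _ (bij A)).trans (Equiv.ofBijective _ (evalRight_bijective A X)).symm
  have hE {A : C} (f : A ⟶ Y) : E A f ▷ X ≫ ε_ X (Xᘁ) = f ▷ X ≫ j.hom :=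
    Equiv.ofBijective_apply_symm_apply _ (evalRight_bijective A X) _
  have t : Y ≅ Xᘁ := Yoneda.ext _ _ (fun {A} => E A) (fun {A} => (E A).symm) (fun f => by simp)
    (fun f => by simp) fun {A B} f g => (evalRight_bijective B X).1 (by
      simp only [hE, comp_whiskerRight, Category.assoc])
  exact ⟨⟨whiskerLeftIso X t.symm ≪≫ i⟩, ⟨whiskerRightIso t.symm X ≪≫ j⟩⟩

end Invertible

/-! ### The two duals of `χ` agree -/

section Main

/-- Since `Hom(R Y, 1) ≅ Hom(Y ⊗ χ, 1) ≅ Hom(Y, c)`, the object `c` is isomorphic to `ᘁ(ᘁc)`. As `ᘁc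
≅ χ`, the pairing of `ᘁ(ᘁc)` with `ᘁc` becomes one of `c` with `χ`. -/
theorem nonempty_exactPairing_of_iso (k : Type w) [Field k]
    {C : Type u₁} [Category.{v₁} C] [Abelian C] [Linear k C] [MonoidalCategory C]
    [RigidCategory C] {D : Type u₂} [Category.{v₂} D] [Abelian D] [Linear k D]
    [MonoidalCategory D] [RigidCategory D] {F : C ⥤ D} [F.Monoidal] [F.Additive] [F.Linear k]
    {L R : D ⥤ C} (adjL : L ⊣ F) (adjR : F ⊣ R) {χ c : D}
    [p : ExactPairing χ c] (i : R ≅ tensorRight χ ⋙ L) : Nonempty (ExactPairing c χ) := by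
  obtain ⟨j⟩ := nonempty_iso_doubleLeftDual adjR c
    (fun Y => (relativeUnit k adjL i Y).toEquiv.trans
      ((tensorRightHomEquiv Y χ c (𝟙_ D)).trans (λ_ c).homToEquiv)) (fun f g => by
      have h := relativeUnit_comp k adjL i f g
      change tensorRightHomEquiv _ χ c (𝟙_ D) (relativeUnit k adjL i _ (R.map f ≫ g)) ≫ _ =
        f ≫ tensorRightHomEquiv _ χ c (𝟙_ D) (relativeUnit k adjL i _ g) ≫ _
      rw [h, tensorRightHomEquiv_naturality_left, Category.assoc])
  have q : ExactPairing (ᘁc : D) c := inferInstance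
  exact ⟨exactPairingCongr j (leftDualIso p q)⟩

end Main

end FinTensor

end

theorem theorem4p8 {k : Type w} [Field k]
    {C : Type u₁} [Category.{v₁} C] [Abelian C] [Linear k C] [MonoidalCategory C]
    [MonoidalPreadditive C] [MonoidalLinear k C] [RigidCategory C] [FinTensor.IsFiniteAbelian k C]
    {D : Type u₂} [Category.{v₂} D] [Abelian D] [Linear k D] [MonoidalCategory D]
    [MonoidalPreadditive D] [MonoidalLinear k D] [RigidCategory D] [FinTensor.IsFiniteAbelian k D]
    (F : C ⥤ D) [F.Monoidal] [F.Additive] [F.Linear k]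
    [PreservesFiniteLimits F] [PreservesFiniteColimits F]
    (hF : FinTensor.RelativeModularCondition F) :
    (∃ χ : D, FinTensor.IsRelativeModularObject F χ) ∧
    ∀ χ : D, FinTensor.IsRelativeModularObject F χ →
      Nonempty (χ ⊗ FinTensor.modularObject k D ≅ F.obj (FinTensor.modularObject k C)) ∧
      Nonempty (F.obj (FinTensor.modularObject k C) ≅ FinTensor.modularObject k D ⊗ χ) ∧
      (FinTensor.IsInvertibleObject (F.obj (FinTensor.modularObject k C)) ∨
          FinTensor.IsInvertibleObject (FinTensor.modularObject k D) →
        Nonempty (χ ≅ F.obj (FinTensor.modularObject k C) ⊗ (FinTensor.modularObject k D)ᘁ) ∧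
        Nonempty (χ ≅ (FinTensor.modularObject k D)ᘁ ⊗ F.obj (FinTensor.modularObject k C))) := by
  refine ⟨FinTensor.exists_isRelativeModularObject k hF, ?_⟩
  rintro χ ⟨L, R, adjL, adjR, ⟨i⟩⟩
  obtain ⟨e⟩ := FinTensor.nonempty_tensor_modularObject_iso_map k adjL adjR i
  obtain ⟨q⟩ := FinTensor.nonempty_exactPairing_of_iso k adjL adjR (c := χᘁ) i
  obtain ⟨s⟩ := FinTensor.nonempty_tensor_modularObject_iso k χ (χᘁ)
  refine ⟨⟨e⟩, ⟨e.symm ≪≫ s⟩, fun h => ?_⟩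
  -- As `χ ⊗ α_D ≅ F α_C ≅ α_D ⊗ χ`, an inverse of `F α_C` gives a left and a right inverse of
  -- `α_D`.
  have hα : FinTensor.IsInvertibleObject (FinTensor.modularObject k D) := by
    rcases h with ⟨Y, ⟨a⟩, ⟨b⟩⟩ | h
    · exact FinTensor.isInvertibleObject_of_left_right
        ((α_ _ _ _).symm ≪≫ whiskerRightIso (s.symm ≪≫ e) Y ≪≫ a)
        (α_ Y χ _ ≪≫ whiskerLeftIso Y e ≪≫ b)
    · exact h
  obtain ⟨⟨a⟩, ⟨b⟩⟩ := hα.tensor_dual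
  exact ⟨⟨(ρ_ χ).symm ≪≫ whiskerLeftIso χ a.symm ≪≫ (α_ _ _ _).symm ≪≫ whiskerRightIso e _⟩,
    ⟨(λ_ χ).symm ≪≫ whiskerRightIso b.symm χ ≪≫ α_ _ _ _ ≪≫
      whiskerLeftIso _ (s.symm ≪≫ e)⟩⟩
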